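/- Let $1\le m\le d$ be integers, $1\le p\le\infty$ and $C_0>0$ (with $m/p=0$ for $p=\infty$). \emph{Besov norm.} Fix a smooth $\rho:\mathbb R^d\to[0,\infty)$ that vanishes outside $\{1/2<|y|<2\}$ and satisfies $\sum_{j\in\mathbb Z}\rho(2^{-j}y)=1$ for $y\ne0$. For $f\in L^p(\mathbb R^d)$ put $$\|f\|_{\dot B^{s}_{p,1}}=\sum_{j\in\mathbb Z}2^{js}\,\bigl\|\mathcal F^{-1}[\rho(2^{-j}\cdot)\mathcal F f]\bigr\|_{L^p},$$ and write $f\in B^{s}_{p,1}$ if $f\in L^p$ and $\|f\|_{\dot B^{s}_{p,1}}<\infty$, with norm $\|f\|_p+\|f\|_{\dot B^s_{p,1}}$. \emph{Sampling sets.} For $b>0$ let $G\subset\mathbb R^d$ be a countable union of $(d-m)$-dimensional $C^1$ submanifolds, or a Borel subset of such a union. To each $a\in G$ let there be attached a set $H_a\ni a$ that is a Borel subset of some $m$-dimensional $C^1$ submanifold, and a measure $\nu_a=\varphi_a\,\mathcal H^m|_{H_a}$ with $\varphi_a$ measurable and $C_0^{-1}\le\varphi_a\le C_0$ almost everywhere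 on $H_a$, such that (i) $b/2\le\operatorname{diam}(H_a)\le b$ for all $a\in G$; (ii) for every Borel set $E\subset\mathbb R^d$ the function $a\mapsto\nu_a(E\cap H_a)$ is $\mathcal H^{d-m}|_G$-measurable and, with $\lambda_d$ the Lebesgue measure, $C_0^{-1}\lambda_d(E)\le\int_G\nu_a(E\cap H_a)\,d\mathcal H^{d-m}(a)\le C_0\lambda_d(E)$; (iii) for all $a\in G$ and $R>0$: $\nu_a(B(x,R)\cap H_a)\ge C_0^{-1}\min(R,b)^m$ for every $x\in H_a$, and $\nu_a(B(x,R)\cap H_a)\le C_0\min(R,b)^m$ for every $x\in\mathbb R^d$; (iv) $\mathcal H^{d-m}(G\cap B(x,R))\le C_0R^{d-m}\max\{1,Rb^{-1}\}^m$ for all $x\in\mathbb R^d$, $R>0$. \emph{Values on $G$.} The restriction of $f\in B^{m/p}_{p,1}$ to $G$ is understood as its trace: a function $g$ on $G$ is a trace of $f$ if there are continuous $u_n\in B^{m/p}_{p,1}$ with $u_n\to f$ in the norm of $B^{m/p}_{p,1}$ and $u_n|_G\to g$ in $L^p(G,\mathcal H^{d-m})$. \textbf{Theorem.} There exist constants $\delta,C_1,C_2>0$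 depending only on $d,p,m,C_0$ (and on the function $\rho$ chosen to define the Besov norm) such that, for all $b$, $G$, $(H_a)$, $(\nu_a)$ as above, all $f\in B^{m/p}_{p,1}(\mathbb R^d)$ and all $N>0$ with $$\|f\|_{\dot B^{m/p}_{p,1}}\le N\|f\|_{p}\qquad\text{and}\qquad b^{m/p}<\delta N^{-1},$$ the function $f$ has a trace on $G$ and every trace $f|_G$ of $f$ satisfies $$C_1\|f\|_{L^p(\mathbb R^d)}\le b^{m/p}\,\bigl\|f|_G\bigr\|_{L^p(G,\mathcal H^{d-m})}\le C_2\|f\|_{L^p(\mathbb R^d)} .$$ -/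

import Mathlib

open MeasureTheory Filter Topology Set
open scoped ENNReal ContDiff FourierTransform

noncomputable section

/-- Euclidean space of dimension `d`. -/
abbrev Euc (d : ℕ) : Type := EuclideanSpace ℝ (Fin d)

/-- A dyadic partition of unity on the frequency side: `ρ` is smooth, non-negative, vanishes off
the annulus `1/2 < |y| < 2`, and its dyadic dilates sum to `1` away from the origin. -/
structure IsDyadicPartition {d : ℕ} (ρ : Euc d → ℝ) : Prop where
  contDiff : ContDiff ℝ ∞ ρ
  nonneg : ∀ y, 0 ≤ ρ y
  support_subset : ∀ y, ρ y ≠ 0 → 1 / 2 < ‖y‖ ∧ ‖y‖ < 2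
  hasSum_one : ∀ y, y ≠ 0 → HasSum (fun j : ℤ => ρ ((2 : ℝ) ^ (-j) • y)) 1

/-- The inverse Fourier transform of `ρ (2 ^ (-j) ·)`, a Schwartz function. -/
def dyadicKernel {d : ℕ} (ρ : Euc d → ℝ) (j : ℤ) : Euc d → ℂ :=
  𝓕⁻ (fun ξ : Euc d => ((ρ ((2 : ℝ) ^ (-j) • ξ) : ℝ) : ℂ))

/-- The dyadic block `𝓕⁻¹[ρ (2 ^ (-j) ·) 𝓕 f]` of a function `f` in some `L^p`, written as the
(absolutely convergent) convolution of `f` with the kernel `𝓕⁻¹[ρ (2 ^ (-j) ·)]`. -/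
def dyadicBlock {d : ℕ} (ρ : Euc d → ℝ) (j : ℤ) (f : Euc d → ℂ) (x : Euc d) : ℂ :=
  ∫ y, dyadicKernel ρ j (x - y) * f y

/-- The norm of the homogeneous Besov space with smoothness `s`, integrability `p` and third
index `1`, that is `∑_j 2 ^ (j s) ‖𝓕⁻¹[ρ (2 ^ (-j) ·) 𝓕 f]‖_p`, with values in `[0, ∞]`. -/
def besovSeminorm {d : ℕ} (ρ : Euc d → ℝ) (s : ℝ) (p : ℝ≥0∞) (f : Euc d → ℂ) : ℝ≥0∞ :=
  ∑' j : ℤ, ENNReal.ofReal ((2 : ℝ) ^ ((j : ℝ) * s)) * eLpNorm (dyadicBlock ρ j f) p volume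

/-- Membership in the Besov space with indices `s`, `p`, `1`: `f` is in `L^p` and its homogeneous
Besov norm is finite. -/
def MemBesov {d : ℕ} (ρ : Euc d → ℝ) (s : ℝ) (p : ℝ≥0∞) (f : Euc d → ℂ) : Prop :=
  MemLp f p volume ∧ besovSeminorm ρ s p f < ⊤

/-- `g` is the trace of `f` in `L^p(μ)`: there are continuous functions `u n` in the Besov space
that converge to `f` in the Besov norm `‖·‖_p + ‖·‖` (homogeneous part) and whose pointwise values
converge to `g` in `L^p(μ)`. If `f` itself is a continuous element of the Besov space, `g = f` is
allowed. -/
def IsBesovTrace {d : ℕ} (ρ : Euc d → ℝ) (s : ℝ) (p : ℝ≥0∞) (μ : Measure (Euc d))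
    (f g : Euc d → ℂ) : Prop :=
  AEStronglyMeasurable g μ ∧
    ∃ u : ℕ → Euc d → ℂ,
      (∀ n, Continuous (u n) ∧ MemBesov ρ s p (u n)) ∧
      Tendsto (fun n => eLpNorm (u n - f) p volume + besovSeminorm ρ s p (u n - f))
        atTop (𝓝 0) ∧
      Tendsto (fun n => eLpNorm (u n - g) p μ) atTop (𝓝 0)

/-- `M` is an embedded `k`-dimensional `C^1` submanifold of `ℝ^d`: near each of its points a
`C^1` diffeomorphism between open sets straightens it to `ℝ^k × {0}`. -/
def IsC1Submanifold {d : ℕ} (k : ℕ) (M : Set (Euc d)) : Prop :=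
  ∀ x ∈ M, ∃ φ : OpenPartialHomeomorph (Euc d) (Euc d),
    x ∈ φ.source ∧ ContDiffOn ℝ 1 φ φ.source ∧ ContDiffOn ℝ 1 φ.symm φ.target ∧
      ∀ y ∈ φ.source, y ∈ M ↔ ∀ i : Fin d, k ≤ (i : ℕ) → φ y i = 0

/-- The sampling set `G`, of codimension `m` and scale `b`, with transversal pieces `H a` carrying
measures `ν a` for `a ∈ G`. -/
structure IsSamplingSet {d : ℕ} (m : ℕ) (b C₀ : ℝ) (G : Set (Euc d))
    (H : Euc d → Set (Euc d)) (ν : Euc d → Measure (Euc d)) : Prop where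
  /-- `G` is a Borel part (possibly all) of a countable union of `C^1` submanifolds of dimension
  `d - m`. -/
  measurableSet : MeasurableSet G
  manifold : ∃ M : ℕ → Set (Euc d), (∀ i, IsC1Submanifold (d - m) (M i)) ∧ G ⊆ ⋃ i, M i
  /-- `H a` is a Borel part of an `m`-dimensional `C^1` submanifold; so `H a` may have a boundary
  and corners, as segments and cubes do. -/
  piece_measurableSet : ∀ a ∈ G, MeasurableSet (H a)
  piece_manifold : ∀ a ∈ G, ∃ M : Set (Euc d), IsC1Submanifold m M ∧ H a ⊆ M
  mem_piece : ∀ a ∈ G, a ∈ H a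
  /-- `ν a` has a density between `C₀⁻¹` and `C₀` with respect to the surface measure of `H a`. -/
  density : ∀ a ∈ G, ∃ φ : Euc d → ℝ≥0∞, Measurable φ ∧
    (∀ᵐ x ∂((μH[(m : ℝ)] : Measure (Euc d)).restrict (H a)),
      ENNReal.ofReal C₀⁻¹ ≤ φ x ∧ φ x ≤ ENNReal.ofReal C₀) ∧
    ν a = ((μH[(m : ℝ)] : Measure (Euc d)).restrict (H a)).withDensity φ
  /-- Diameter of the pieces. -/
  diam_piece : ∀ a ∈ G, b / 2 ≤ Metric.diam (H a) ∧ Metric.diam (H a) ≤ b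
  /-- Fubini-type equivalence with Lebesgue measure. -/
  aemeasurable_fubini : ∀ E : Set (Euc d), MeasurableSet E →
    AEMeasurable (fun a => ν a (E ∩ H a))
      ((μH[((d - m : ℕ) : ℝ)] : Measure (Euc d)).restrict G)
  fubini : ∀ E : Set (Euc d), MeasurableSet E →
    ENNReal.ofReal C₀⁻¹ * volume E
        ≤ ∫⁻ a in G, ν a (E ∩ H a) ∂(μH[((d - m : ℕ) : ℝ)] : Measure (Euc d)) ∧
      ∫⁻ a in G, ν a (E ∩ H a) ∂(μH[((d - m : ℕ) : ℝ)] : Measure (Euc d))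
        ≤ ENNReal.ofReal C₀ * volume E
  /-- Ball-measure bounds: from below for balls centred on the piece, from above for all balls. -/
  piece_lower : ∀ a ∈ G, ∀ x ∈ H a, ∀ R : ℝ, 0 < R →
    ENNReal.ofReal (C₀⁻¹ * min R b ^ m) ≤ ν a (Metric.ball x R ∩ H a)
  piece_upper : ∀ a ∈ G, ∀ x : Euc d, ∀ R : ℝ, 0 < R →
    ν a (Metric.ball x R ∩ H a) ≤ ENNReal.ofReal (C₀ * min R b ^ m)
  /-- Density bound for `G`. -/
  density_bound : ∀ x : Euc d, ∀ R : ℝ, 0 < R →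
    (μH[((d - m : ℕ) : ℝ)] : Measure (Euc d)) (G ∩ Metric.ball x R)
      ≤ ENNReal.ofReal (C₀ * R ^ (d - m) * max 1 (R * b⁻¹) ^ m)

end

/-! Write `s = m/p`, let `P_J` be the low-pass filter at frequency `2^J`, and take `2^J` comparable
to `t/b` with a small constant `t`. The proof splits `f = h + (f - h)` with `h = P_J f`.

The high part is small because of the Besov bound. The telescoping identity `P_j - P_{j-1} = Δ_j`
(`dyadicBlock_eq`) writes `f - h` as the sum of the blocks with `j > J`, so its `L^p` norm is at
most `(2b/t)^s` times the seminorm, hence at most a constant times `δ ‖f‖_p`. The same holds on `G`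
after multiplication by `b^s`. Indeed `Δ_j f = P_{j+1} Δ_j f`, and Schur's test from Lebesgue
measure to the surface measure, with the density bound on `G`, costs a factor `2^{js}` on each
block. This is the trace inequality `IsBesovTrace.eLpNorm_sub_lowPass_le`; it holds for every trace,
and the summability behind it also produces one (`exists_isBesovTrace`).

The low part is nearly constant at scale `b`: for `x` in `H a`, `|h x - h a|` is at most a constant
times `t` times a weighted average of `|f|` at `x`. Integrating over the pieces and using the Fubini
condition compares `‖h‖_p` with `b^s ‖h‖_{L^p(G)}` up to `O(t) ‖f‖_p`
(`IsSamplingSet.eLpNorm_lowPass_le`).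

All errors in the lower bound add up to at most `‖f‖_p / 2` and are absorbed. The upper bound is
Schur's test for `h` plus the trace inequality for the rest. For `p = ∞` the conventions `m / 0 = 0`
and `1 / 0 = 0` give the correct exponents. -/

/-! ### The low-pass cutoff attached to `ρ` -/

/-- The smooth cutoff equal to `1` on the unit ball and to `ρ` off it. It is the sum of the dyadic
dilates of `ρ` of non-positive index. -/
noncomputable def lowPassSymbol {d : ℕ} (ρ : Euc d → ℝ) (ξ : Euc d) : ℝ :=
  open scoped Classical in if ‖ξ‖ ≤ 1 then 1 else ρ ξ

namespace IsDyadicPartition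

variable {d : ℕ} {ρ : Euc d → ℝ}

theorem eq_zero_of_norm_le (hρ : IsDyadicPartition ρ) {ξ : Euc d} (h : ‖ξ‖ ≤ 1 / 2) : ρ ξ = 0 := by
  by_contra h0
  exact absurd (hρ.support_subset ξ h0).1 (not_lt.2 h)

theorem eq_zero_of_le_norm (hρ : IsDyadicPartition ρ) {ξ : Euc d} (h : 2 ≤ ‖ξ‖) : ρ ξ = 0 := by
  by_contra h0
  exact absurd (hρ.support_subset ξ h0).2 (not_lt.2 h)

/-- On this annulus only the dilates `j = 0` and `j = 1` of the partition can be non-zero. -/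
theorem add_half_eq_one (hρ : IsDyadicPartition ρ) {ξ : Euc d} (h1 : 1 ≤ ‖ξ‖) (h2 : ‖ξ‖ ≤ 2) :
    ρ ξ + ρ ((2 : ℝ)⁻¹ • ξ) = 1 := by
  have hξ : ξ ≠ 0 := by
    rintro rfl
    norm_num at h1
  have hs := hρ.hasSum_one ξ hξ
  have hz : ∀ j ∉ ({0, 1} : Finset ℤ), ρ ((2 : ℝ) ^ (-j) • ξ) = 0 := by
    intro j hj
    simp only [Finset.mem_insert, Finset.mem_singleton, not_or] at hj
    rcases lt_or_ge j 0 with hneg | hpos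
    · apply hρ.eq_zero_of_le_norm
      rw [norm_smul, Real.norm_of_nonneg (by positivity)]
      have : (2 : ℝ) ^ (1 : ℤ) ≤ 2 ^ (-j) := zpow_le_zpow_right₀ one_le_two (by omega)
      rw [zpow_one] at this
      nlinarith
    · apply hρ.eq_zero_of_norm_le
      rw [norm_smul, Real.norm_of_nonneg (by positivity)]
      have : (2 : ℝ) ^ (-j) ≤ 2 ^ (-2 : ℤ) := zpow_le_zpow_right₀ one_le_two (by omega)
      rw [show (2 : ℝ) ^ (-2 : ℤ) = 1 / 4 by norm_num] at this
      nlinarith [norm_nonneg ξ]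
  have := hs.unique (hasSum_sum_of_ne_finset_zero hz)
  simpa using this.symm

end IsDyadicPartition

section Symbol

variable {d : ℕ} {ρ : Euc d → ℝ}

theorem lowPassSymbol_of_norm_le {ξ : Euc d} (h : ‖ξ‖ ≤ 1) : lowPassSymbol ρ ξ = 1 := by
  simp [lowPassSymbol, h]

theorem lowPassSymbol_of_one_lt {ξ : Euc d} (h : 1 < ‖ξ‖) : lowPassSymbol ρ ξ = ρ ξ := by
  simp [lowPassSymbol, h.not_ge]

theorem lowPassSymbol_of_two_le (hρ : IsDyadicPartition ρ) {ξ : Euc d} (h : 2 ≤ ‖ξ‖) :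
    lowPassSymbol ρ ξ = 0 := by
  rw [lowPassSymbol_of_one_lt (by linarith), hρ.eq_zero_of_le_norm h]

/-- The telescoping identity: it makes each dyadic block a difference of two consecutive low-pass
filters. -/
theorem lowPassSymbol_half_sub (hρ : IsDyadicPartition ρ) (ξ : Euc d) :
    lowPassSymbol ρ ((2 : ℝ)⁻¹ • ξ) - lowPassSymbol ρ ξ = ρ ((2 : ℝ)⁻¹ • ξ) := by
  have hn : ‖(2 : ℝ)⁻¹ • ξ‖ = ‖ξ‖ / 2 := by
    rw [norm_smul, Real.norm_of_nonneg (by norm_num)]; ring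
  rcases le_or_gt ‖ξ‖ 1 with h1 | h1
  · rw [lowPassSymbol_of_norm_le h1, lowPassSymbol_of_norm_le (by linarith),
      hρ.eq_zero_of_norm_le (by linarith), sub_self]
  rcases le_or_gt ‖ξ‖ 2 with h2 | h2
  · rw [lowPassSymbol_of_norm_le (by linarith), lowPassSymbol_of_one_lt h1,
      ← hρ.add_half_eq_one h1.le h2, add_sub_cancel_left]
  · rw [lowPassSymbol_of_one_lt (by linarith), lowPassSymbol_of_two_le hρ h2.le, sub_zero]

/-- The definition by cases hides smoothness across the unit sphere. Inside the ball of radius 2 the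
symbol is `1 - ρ(ξ/2)`, near all other points it is `ρ`, and the two regions cover the space. -/
theorem contDiff_lowPassSymbol (hρ : IsDyadicPartition ρ) : ContDiff ℝ ∞ (lowPassSymbol ρ) := by
  rw [contDiff_iff_contDiffAt]
  intro ξ
  rcases lt_or_ge ‖ξ‖ 2 with h2 | h2
  · have hs : ContDiff ℝ ∞ (fun η : Euc d => 1 - ρ ((2 : ℝ)⁻¹ • η)) :=
      contDiff_const.sub (hρ.contDiff.comp (contDiff_const_smul _))
    refine hs.contDiffAt.congr_of_eventuallyEq ?_
    filter_upwards [continuous_norm.continuousAt.eventually_lt_const h2] with η hη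
    have := lowPassSymbol_half_sub hρ η
    rw [lowPassSymbol_of_norm_le (ξ := (2 : ℝ)⁻¹ • η)] at this
    · linarith
    · rw [norm_smul, Real.norm_of_nonneg (by norm_num)]
      linarith
  · refine hρ.contDiff.contDiffAt.congr_of_eventuallyEq ?_
    filter_upwards [continuous_norm.continuousAt.eventually_const_lt
      (show (1 : ℝ) < ‖ξ‖ by linarith)] with η hη
    exact lowPassSymbol_of_one_lt hη

/-- The cutoff at frequency `2 ^ n`. -/
noncomputable def dilatedSymbol (ρ : Euc d → ℝ) (n : ℤ) (ξ : Euc d) : ℂ :=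
  ((lowPassSymbol ρ ((2 : ℝ) ^ (-n) • ξ) : ℝ) : ℂ)

theorem norm_two_zpow_smul (n : ℤ) (ξ : Euc d) : ‖(2 : ℝ) ^ n • ξ‖ = 2 ^ n * ‖ξ‖ := by
  rw [norm_smul, Real.norm_of_nonneg (by positivity)]

theorem two_zpow_neg_mul_le_iff {n : ℤ} {x y : ℝ} : (2 : ℝ) ^ (-n) * x ≤ y ↔ x ≤ 2 ^ n * y := by
  rw [zpow_neg, inv_mul_le_iff₀ (by positivity)]

theorem le_two_zpow_neg_mul_iff {n : ℤ} {x y : ℝ} : x ≤ (2 : ℝ) ^ (-n) * y ↔ 2 ^ n * x ≤ y := by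
  rw [zpow_neg, le_inv_mul_iff₀ (by positivity)]

theorem contDiff_dilatedSymbol (hρ : IsDyadicPartition ρ) (n : ℤ) :
    ContDiff ℝ ∞ (dilatedSymbol ρ n) :=
  Complex.ofRealCLM.contDiff.comp ((contDiff_lowPassSymbol hρ).comp (contDiff_const_smul _))

theorem dilatedSymbol_eq_zero (hρ : IsDyadicPartition ρ) {n : ℤ} {ξ : Euc d}
    (h : 2 ^ n * 2 ≤ ‖ξ‖) : dilatedSymbol ρ n ξ = 0 := by
  rw [dilatedSymbol, lowPassSymbol_of_two_le hρ, Complex.ofReal_zero]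
  rwa [norm_two_zpow_smul, le_two_zpow_neg_mul_iff]

theorem dilatedSymbol_eq_one {n : ℤ} {ξ : Euc d} (h : ‖ξ‖ ≤ 2 ^ n) :
    dilatedSymbol ρ n ξ = 1 := by
  rw [dilatedSymbol, lowPassSymbol_of_norm_le, Complex.ofReal_one]
  rw [norm_two_zpow_smul, two_zpow_neg_mul_le_iff]
  simpa using h

theorem hasCompactSupport_dilatedSymbol (hρ : IsDyadicPartition ρ) (n : ℤ) :
    HasCompactSupport (dilatedSymbol ρ n) := by
  refine HasCompactSupport.of_support_subset_isCompact
    (isCompact_closedBall (0 : Euc d) (2 ^ n * 2)) fun ξ hξ => ?_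
  by_contra h
  rw [mem_closedBall_zero_iff, not_le] at h
  exact hξ (dilatedSymbol_eq_zero hρ h.le)

/-- The coarser symbol vanishes for `‖ξ‖ ≥ 2^(k+1)`, and the finer one is 1 for `‖ξ‖ ≤ 2^n`, where
`k + 1 ≤ n`. The strict inequality is needed. -/
theorem dilatedSymbol_mul (hρ : IsDyadicPartition ρ) {k n : ℤ} (h : k < n) (ξ : Euc d) :
    dilatedSymbol ρ n ξ * dilatedSymbol ρ k ξ = dilatedSymbol ρ k ξ := by
  rcases le_or_gt ‖ξ‖ (2 ^ n) with h1 | h1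
  · rw [dilatedSymbol_eq_one h1, one_mul]
  · rw [dilatedSymbol_eq_zero (n := k) hρ, mul_zero]
    refine le_trans ?_ h1.le
    rw [← zpow_add_one₀ two_ne_zero]
    exact zpow_le_zpow_right₀ one_le_two (by omega)

theorem dilatedSymbol_sub (hρ : IsDyadicPartition ρ) (j : ℤ) (ξ : Euc d) :
    dilatedSymbol ρ j ξ - dilatedSymbol ρ (j - 1) ξ = ((ρ ((2 : ℝ) ^ (-j) • ξ) : ℝ) : ℂ) := by
  have h : (2 : ℝ) ^ (-j) • ξ = (2 : ℝ)⁻¹ • (2 : ℝ) ^ (-(j - 1)) • ξ := by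
    rw [smul_smul]
    congr 1
    rw [neg_sub, sub_eq_add_neg, zpow_add₀ two_ne_zero, zpow_one, inv_mul_cancel_left₀ two_ne_zero]
  rw [dilatedSymbol, dilatedSymbol, ← Complex.ofReal_sub, h, lowPassSymbol_half_sub hρ]

end Symbol

/-! ### Low-pass kernels: convolution and scaling -/

section Kernel

open SchwartzMap

variable {d : ℕ} {ρ : Euc d → ℝ}

/-- The cutoff at frequency `2 ^ n` as a Schwartz function. -/
noncomputable def schwartzSymbol (hρ : IsDyadicPartition ρ) (n : ℤ) : 𝓢(Euc d, ℂ) :=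
  (hasCompactSupport_dilatedSymbol hρ n).toSchwartzMap (contDiff_dilatedSymbol hρ n)

theorem schwartzSymbol_apply (hρ : IsDyadicPartition ρ) (n : ℤ) (ξ : Euc d) :
    schwartzSymbol hρ n ξ = dilatedSymbol ρ n ξ := rfl

/-- The kernel of the low-pass filter at frequency `2 ^ n`. -/
noncomputable def lowPassKernel (hρ : IsDyadicPartition ρ) (n : ℤ) : 𝓢(Euc d, ℂ) :=
  𝓕⁻ (schwartzSymbol hρ n)

theorem fourier_lowPassKernel (hρ : IsDyadicPartition ρ) (n : ℤ) :
    𝓕 (lowPassKernel hρ n) = schwartzSymbol hρ n := by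
  simp [lowPassKernel]

theorem dyadicKernel_eq (hρ : IsDyadicPartition ρ) (j : ℤ) (x : Euc d) :
    dyadicKernel ρ j x = lowPassKernel hρ j x - lowPassKernel hρ (j - 1) x := by
  have h : (fun ξ : Euc d => ((ρ ((2 : ℝ) ^ (-j) • ξ) : ℝ) : ℂ))
      = (schwartzSymbol hρ j - schwartzSymbol hρ (j - 1) : 𝓢(Euc d, ℂ)) := by
    ext ξ
    rw [_root_.sub_apply, schwartzSymbol_apply, schwartzSymbol_apply, dilatedSymbol_sub hρ]
  rw [dyadicKernel, h, ← SchwartzMap.fourierInv_coe, lowPassKernel, lowPassKernel,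
    ← _root_.sub_apply]
  congr 1
  exact map_sub (FourierTransform.fourierInvCLM ℂ 𝓢(Euc d, ℂ)) _ _

theorem integral_lowPassKernel (hρ : IsDyadicPartition ρ) (n : ℤ) :
    ∫ x, lowPassKernel hρ n x = 1 := by
  have h := congrArg (fun g : 𝓢(Euc d, ℂ) => g 0) (fourier_lowPassKernel hρ n)
  simp only [schwartzSymbol_apply] at h
  rw [dilatedSymbol_eq_one (by simp; positivity), SchwartzMap.fourier_coe,
    Real.fourier_eq] at h
  simpa using h

/-- On the Fourier side convolution becomes the product of symbols, which `dilatedSymbol_mul`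
evaluates. -/
theorem integral_lowPassKernel_mul (hρ : IsDyadicPartition ρ) {k n : ℤ} (h : k < n) (x z : Euc d) :
    ∫ y, lowPassKernel hρ n (x - y) * lowPassKernel hρ k (y - z) = lowPassKernel hρ k (x - z) := by
  have hc : convolution (ContinuousLinearMap.mul ℂ ℂ) (lowPassKernel hρ k) (lowPassKernel hρ n)
      = lowPassKernel hρ k := by
    apply (FourierTransform.fourierEquiv ℂ 𝓢(Euc d, ℂ)).injective
    ext ξ
    simp only [FourierTransform.fourierEquiv_apply]
    rw [fourier_convolution, fourier_lowPassKernel, fourier_lowPassKernel]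
    simp only [pairing_apply_apply, ContinuousLinearMap.mul_apply', schwartzSymbol_apply]
    rw [mul_comm, dilatedSymbol_mul hρ h]
  have := convolution_apply (ContinuousLinearMap.mul ℂ ℂ) (lowPassKernel hρ k)
    (lowPassKernel hρ n) (x - z)
  rw [hc] at this
  rw [this, convolution_def, ← integral_add_right_eq_self _ z]
  refine integral_congr_ae (Eventually.of_forall fun y => ?_)
  simp only [ContinuousLinearMap.mul_apply']
  rw [mul_comm, add_sub_cancel_right, sub_sub, add_comm z]

/-- Scaling reduces every estimate, uniformly in `n`, to the single Schwartz function with `n = 0`.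
-/
theorem lowPassKernel_apply (hρ : IsDyadicPartition ρ) (n : ℤ) (x : Euc d) :
    lowPassKernel hρ n x = (((2 : ℝ) ^ n) ^ d : ℝ) * lowPassKernel hρ 0 ((2 : ℝ) ^ n • x) := by
  have h2 : (0 : ℝ) < 2 ^ n := by positivity
  have hs : ∀ k, (lowPassKernel hρ k : Euc d → ℂ) = 𝓕⁻ (dilatedSymbol ρ k) := by
    intro k
    rw [lowPassKernel, SchwartzMap.fourierInv_coe]
    rfl
  rw [hs, hs, Real.fourierInv_eq', Real.fourierInv_eq']
  have := Measure.integral_comp_smul (volume : Measure (Euc d))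
    (fun v => Complex.exp (↑(2 * Real.pi * inner ℝ v ((2 : ℝ) ^ n • x)) * Complex.I) •
      dilatedSymbol ρ 0 v) ((2 : ℝ) ^ (-n))
  rw [finrank_euclideanSpace_fin] at this
  rw [show |(((2 : ℝ) ^ (-n)) ^ d)⁻¹| = ((2 : ℝ) ^ n) ^ d by
    rw [abs_of_nonneg (by positivity), zpow_neg, inv_pow, inv_inv]] at this
  rw [Complex.real_smul] at this
  rw [← this]
  refine integral_congr_ae (Eventually.of_forall fun ξ => ?_)
  simp only [inner_smul_left, inner_smul_right, dilatedSymbol]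
  simp [h2.ne']

end Kernel

/-! ### Decay and regularity of the kernels -/

section Decay

open SchwartzMap

theorem SchwartzMap.exists_norm_le_div_pow {E F : Type*} [NormedAddCommGroup E] [NormedSpace ℝ E]
    [NormedAddCommGroup F] [NormedSpace ℝ F] (f : 𝓢(E, F)) (k : ℕ) :
    ∃ C : ℝ, 0 ≤ C ∧ ∀ x, ‖f x‖ ≤ C / (1 + ‖x‖) ^ k := by
  refine ⟨2 ^ k * (Finset.Iic (k, 0)).sup (fun m => SchwartzMap.seminorm ℝ m.1 m.2) f,
    by positivity, fun x => ?_⟩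
  rw [le_div_iff₀ (by positivity), mul_comm]
  have := SchwartzMap.one_add_le_sup_seminorm_apply (𝕜 := ℝ) (m := (k, 0)) le_rfl le_rfl f x
  simpa using this

theorem SchwartzMap.exists_norm_sub_le_div_pow {E F : Type*} [NormedAddCommGroup E]
    [NormedSpace ℝ E] [NormedAddCommGroup F] [NormedSpace ℝ F] (f : 𝓢(E, F)) (k : ℕ) :
    ∃ C : ℝ, 0 ≤ C ∧ ∀ x y, ‖x - y‖ ≤ 1 → ‖f x - f y‖ ≤ C * ‖x - y‖ / (1 + ‖x‖) ^ k := by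
  obtain ⟨C, hC, h⟩ := (SchwartzMap.fderivCLM ℝ E F f).exists_norm_le_div_pow k
  refine ⟨C * 2 ^ k, by positivity, fun x y hxy => ?_⟩
  -- On a ball of radius at most 1 around `x`, `1 + ‖x‖ ≤ 2 (1 + ‖z‖)`, so the decay at `z`
  -- transfers to `x` at the cost of `2^k`.
  have hb : ∀ z ∈ Metric.closedBall x ‖x - y‖, ‖fderiv ℝ f z‖ ≤ C * 2 ^ k / (1 + ‖x‖) ^ k := by
    intro z hz
    rw [mem_closedBall_iff_norm] at hz
    have h1 := h z
    rw [SchwartzMap.fderivCLM_apply] at h1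
    refine h1.trans ?_
    rw [div_le_div_iff₀ (by positivity) (by positivity), mul_assoc, ← mul_pow]
    have h2 : ‖x‖ ≤ ‖z‖ + 1 := by
      have := norm_sub_norm_le x z
      rw [norm_sub_rev] at this
      linarith
    gcongr
    linarith [norm_nonneg z]
  have := (convex_closedBall x ‖x - y‖).norm_image_sub_le_of_norm_fderiv_le
    (fun z _ => f.differentiableAt) hb
    (y := x) (x := y) (by rw [mem_closedBall_iff_norm, norm_sub_rev])
    (Metric.mem_closedBall_self (norm_nonneg _))
  refine this.trans (le_of_eq ?_)
  ring

variable {d : ℕ} {ρ : Euc d → ℝ}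

/-- The `L^1`-normalised polynomially decaying weight at scale `2 ^ (-n)`. -/
noncomputable def decayWeight (n : ℤ) (z : Euc d) : ℝ :=
  ((2 : ℝ) ^ n) ^ d / (1 + 2 ^ n * ‖z‖) ^ (d + 2)

theorem decayWeight_nonneg (n : ℤ) (z : Euc d) : 0 ≤ decayWeight n z := by
  unfold decayWeight
  positivity

theorem decayWeight_le (n : ℤ) (z : Euc d) : decayWeight n z ≤ ((2 : ℝ) ^ n) ^ d := by
  unfold decayWeight
  have h : (0 : ℝ) ≤ 2 ^ n * ‖z‖ := by positivity
  exact div_le_self (by positivity) (one_le_pow₀ (by linarith))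

theorem decayWeight_neg (n : ℤ) (z : Euc d) : decayWeight n (-z) = decayWeight n z := by
  simp [decayWeight]

theorem continuous_decayWeight (n : ℤ) : Continuous (decayWeight n : Euc d → ℝ) := by
  unfold decayWeight
  refine continuous_const.div (by fun_prop) fun z => ?_
  positivity

theorem exists_lowPassKernel_decay (hρ : IsDyadicPartition ρ) : ∃ K : ℝ, 0 < K ∧
    (∀ n z, ‖lowPassKernel hρ n z‖ ≤ K * decayWeight n z) ∧
    ∀ n u v, 2 ^ n * ‖u - v‖ ≤ 1 →
      ‖lowPassKernel hρ n u - lowPassKernel hρ n v‖ ≤ K * (2 ^ n * ‖u - v‖) * decayWeight n u := by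
  obtain ⟨C₁, hC₁, h₁⟩ := (lowPassKernel hρ 0).exists_norm_le_div_pow (d + 2)
  obtain ⟨C₂, hC₂, h₂⟩ := (lowPassKernel hρ 0).exists_norm_sub_le_div_pow (d + 2)
  refine ⟨C₁ + C₂ + 1, by positivity, fun n z => ?_, fun n u v huv => ?_⟩
  · rw [lowPassKernel_apply, norm_mul, Complex.norm_real, Real.norm_of_nonneg (by positivity)]
    have := h₁ ((2 : ℝ) ^ n • z)
    rw [norm_two_zpow_smul] at this
    calc _ ≤ ((2 : ℝ) ^ n) ^ d * (C₁ / (1 + 2 ^ n * ‖z‖) ^ (d + 2)) := by gcongr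
      _ = C₁ * decayWeight n z := by rw [decayWeight]; ring
      _ ≤ _ := mul_le_mul_of_nonneg_right (by linarith) (decayWeight_nonneg n z)
  · have h := h₂ ((2 : ℝ) ^ n • u) ((2 : ℝ) ^ n • v)
    rw [← smul_sub, norm_two_zpow_smul, norm_two_zpow_smul] at h
    rw [lowPassKernel_apply, lowPassKernel_apply hρ n v, ← mul_sub, norm_mul, Complex.norm_real,
      Real.norm_of_nonneg (by positivity)]
    calc _ ≤ ((2 : ℝ) ^ n) ^ d * (C₂ * (2 ^ n * ‖u - v‖) / (1 + 2 ^ n * ‖u‖) ^ (d + 2)) := by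
          gcongr; exact h huv
      _ = C₂ * (2 ^ n * ‖u - v‖) * decayWeight n u := by rw [decayWeight]; ring
      _ ≤ _ := by
        refine mul_le_mul_of_nonneg_right ?_ (decayWeight_nonneg n u)
        gcongr
        linarith

end Decay

/-! ### Schur's test -/

section Schur

variable {α β : Type*} [MeasurableSpace α] [MeasurableSpace β]

/-- Hölder's inequality for the factorisation `k F = k^(1-1/q) (k F^q)^(1/q)`. -/
theorem lintegral_mul_rpow_le {μ : Measure β} {k F : β → ℝ≥0∞} (hk : Measurable k)
    (hF : Measurable F) {A : ℝ≥0∞} (hA : ∫⁻ y, k y ∂μ ≤ A) {q : ℝ} (hq : 1 ≤ q) :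
    (∫⁻ y, k y * F y ∂μ) ^ q ≤ A ^ (q - 1) * ∫⁻ y, k y * F y ^ q ∂μ := by
  have hq0 : 0 < q := by linarith
  have hq1 : 1 / q ≤ 1 := by rw [div_le_one hq0]; exact hq
  have h := ENNReal.lintegral_mul_norm_pow_le (μ := μ) hk.aemeasurable
    (hk.mul (hF.pow_const q)).aemeasurable (p := 1 - 1 / q) (q := 1 / q) (by linarith)
    (by positivity) (by ring)
  have he : ∀ y, k y ^ (1 - 1 / q) * (k * fun y => F y ^ q) y ^ (1 / q) = k y * F y := by
    intro y
    simp only [Pi.mul_apply]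
    rw [ENNReal.mul_rpow_of_nonneg _ _ (by positivity), ← ENNReal.rpow_mul,
      mul_one_div_cancel hq0.ne', ENNReal.rpow_one, ← mul_assoc,
      ← ENNReal.rpow_add_of_nonneg _ _ (by linarith) (by positivity), sub_add_cancel,
      ENNReal.rpow_one]
  simp_rw [he] at h
  calc _ ≤ ((∫⁻ y, k y ∂μ) ^ (1 - 1 / q) * (∫⁻ y, (k * fun y => F y ^ q) y ∂μ) ^ (1 / q)) ^ q := by
        gcongr
    _ = (∫⁻ y, k y ∂μ) ^ (q - 1) * ∫⁻ y, k y * F y ^ q ∂μ := by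
        rw [ENNReal.mul_rpow_of_nonneg _ _ hq0.le, ← ENNReal.rpow_mul, ← ENNReal.rpow_mul,
          one_div_mul_cancel hq0.ne', ENNReal.rpow_one, sub_mul, one_div_mul_cancel hq0.ne',
          one_mul]
        rfl
    _ ≤ _ := by gcongr

/-- Schur's test for a non-negative kernel on `L^p`. -/
theorem eLpNorm_lintegral_mul_le {μ : Measure α} {lam : Measure β} [SFinite μ] [SFinite lam]
    {k : α → β → ℝ≥0∞} (hk : Measurable (Function.uncurry k)) {F : β → ℝ≥0∞}
    (hF : AEMeasurable F lam) {A B : ℝ≥0∞} (hA : ∀ x, ∫⁻ y, k x y ∂lam ≤ A)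
    (hB : ∀ y, ∫⁻ x, k x y ∂μ ≤ B) {p : ℝ≥0∞} (hp : 1 ≤ p) :
    eLpNorm (fun x => ∫⁻ y, k x y * F y ∂lam) p μ
      ≤ A ^ (1 - 1 / p.toReal) * B ^ (1 / p.toReal) * eLpNorm F p lam := by
  wlog hm : Measurable F generalizing F
  · have h := this hF.measurable_mk.aemeasurable hF.measurable_mk
    rw [← eLpNorm_congr_ae hF.ae_eq_mk] at h
    convert h using 2
    funext x
    refine lintegral_congr_ae ?_
    filter_upwards [hF.ae_eq_mk] with y hy
    rw [hy]
  rcases eq_or_ne p ∞ with rfl | hpt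
  · simp only [ENNReal.toReal_top, div_zero, sub_zero, ENNReal.rpow_one, ENNReal.rpow_zero, mul_one,
      eLpNorm_exponent_top]
    refine eLpNormEssSup_le_of_ae_enorm_bound (Eventually.of_forall fun x => ?_)
    rw [enorm_eq_self]
    calc ∫⁻ y, k x y * F y ∂lam ≤ ∫⁻ y, k x y * eLpNormEssSup F lam ∂lam := by
          refine lintegral_mono_ae ?_
          filter_upwards [enorm_ae_le_eLpNormEssSup F lam] with y hy
          gcongr
          simpa using hy
      _ = (∫⁻ y, k x y ∂lam) * eLpNormEssSup F lam :=
          lintegral_mul_const _ (hk.comp measurable_prodMk_left)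
      _ ≤ _ := by gcongr; exact hA x
  have hp0 : p ≠ 0 := (zero_lt_one.trans_le hp).ne'
  have hq : 1 ≤ p.toReal := by
    rw [← ENNReal.toReal_one]
    exact ENNReal.toReal_mono hpt hp
  set q := p.toReal
  have hq0 : 0 < q := by linarith
  rw [eLpNorm_eq_lintegral_rpow_enorm_toReal hp0 hpt, eLpNorm_eq_lintegral_rpow_enorm_toReal hp0 hpt]
  simp only [enorm_eq_self]
  have h : ∫⁻ x, (∫⁻ y, k x y * F y ∂lam) ^ q ∂μ ≤ A ^ (q - 1) * (B * ∫⁻ y, F y ^ q ∂lam) := by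
    calc _ ≤ ∫⁻ x, A ^ (q - 1) * ∫⁻ y, k x y * F y ^ q ∂lam ∂μ :=
          lintegral_mono fun x =>
            lintegral_mul_rpow_le (hk.comp measurable_prodMk_left) hm (hA x) hq
      _ = A ^ (q - 1) * ∫⁻ x, ∫⁻ y, k x y * F y ^ q ∂lam ∂μ := by
          refine lintegral_const_mul _ (Measurable.lintegral_prod_right' (f := fun z : α × β =>
            k z.1 z.2 * F z.2 ^ q) ?_)
          exact hk.mul ((hm.comp measurable_snd).pow_const q)
      _ = A ^ (q - 1) * ∫⁻ y, (∫⁻ x, k x y ∂μ) * F y ^ q ∂lam := by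
          rw [lintegral_lintegral_swap
            (hk.mul ((hm.comp measurable_snd).pow_const q)).aemeasurable]
          congr 1
          refine lintegral_congr fun y => lintegral_mul_const _ (hk.comp measurable_prodMk_right)
      _ ≤ A ^ (q - 1) * ∫⁻ y, B * F y ^ q ∂lam := by
          gcongr with y
          exact hB y
      _ = _ := by rw [lintegral_const_mul _ (hm.pow_const q)]
  calc _ ≤ (A ^ (q - 1) * (B * ∫⁻ y, F y ^ q ∂lam)) ^ (1 / q) := by gcongr
    _ = _ := by
      rw [ENNReal.mul_rpow_of_nonneg _ _ (by positivity),
        ENNReal.mul_rpow_of_nonneg _ _ (by positivity), ← ENNReal.rpow_mul, mul_assoc, sub_mul,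
        mul_one_div_cancel hq0.ne', one_mul]

end Schur

theorem one_div_toReal_le_one {p : ℝ≥0∞} (hp : 1 ≤ p) : 1 / p.toReal ≤ 1 := by
  rcases eq_or_ne p ∞ with rfl | hpt
  · simp
  · have : 1 ≤ p.toReal := by
      rw [← ENNReal.toReal_one]
      exact ENNReal.toReal_mono hpt hp
    exact (div_le_one (by linarith)).2 this

/-! ### Mass of the weights and weighted averages -/

section Weight

variable {d : ℕ}

/-- `∑_{k ≥ 1} k^{-2}`, as an extended non-negative real. -/
noncomputable def inverseSquareSum : ℝ≥0∞ := ∑' k : ℕ, ENNReal.ofReal (1 / ((k : ℝ) + 1) ^ 2)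

theorem inverseSquareSum_ne_top : inverseSquareSum ≠ ⊤ := by
  have h : Summable fun k : ℕ => 1 / ((k : ℝ) + 1) ^ 2 := by
    have := (summable_nat_add_iff 1).2 (Real.summable_one_div_nat_pow.2 one_lt_two)
    simpa using this
  rw [inverseSquareSum, ← ENNReal.ofReal_tsum_of_nonneg (fun k => by positivity) h]
  exact ENNReal.ofReal_ne_top

/-- The single index `k = ⌊2^n ‖x - y‖⌋` already dominates. Majorising by balls means that only ball
masses of a measure are needed to integrate the weight. -/
theorem decayWeight_le_tsum (n : ℤ) (x y : Euc d) :
    ENNReal.ofReal (decayWeight n (x - y)) ≤ ∑' k : ℕ,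
      (Metric.ball x (((k : ℝ) + 1) * 2 ^ (-n))).indicator
        (fun _ => ENNReal.ofReal (((2 : ℝ) ^ n) ^ d / ((k : ℝ) + 1) ^ (d + 2))) y := by
  have hx : (0 : ℝ) ≤ 2 ^ n * ‖x - y‖ := by positivity
  refine le_trans ?_ (ENNReal.le_tsum ⌊2 ^ n * ‖x - y‖⌋₊)
  rw [indicator_of_mem]
  · apply ENNReal.ofReal_le_ofReal
    unfold decayWeight
    rw [add_comm (1 : ℝ)]
    gcongr
    exact Nat.floor_le hx
  · rw [Metric.mem_ball, dist_comm, dist_eq_norm, mul_comm, ← not_le, two_zpow_neg_mul_le_iff,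
      not_le]
    exact Nat.lt_floor_add_one _

theorem lintegral_decayWeight_le_tsum (μ : Measure (Euc d)) (n : ℤ) (x : Euc d) :
    ∫⁻ y, ENNReal.ofReal (decayWeight n (x - y)) ∂μ ≤ ∑' k : ℕ,
      ENNReal.ofReal (((2 : ℝ) ^ n) ^ d / ((k : ℝ) + 1) ^ (d + 2)) *
        μ (Metric.ball x (((k : ℝ) + 1) * 2 ^ (-n))) := by
  refine (lintegral_mono fun y => decayWeight_le_tsum n x y).trans ?_
  rw [lintegral_tsum fun k => (measurable_const.indicator measurableSet_ball).aemeasurable]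
  refine ENNReal.tsum_le_tsum fun k => ?_
  rw [lintegral_indicator_const measurableSet_ball]

/-- Growth `(k+1)^d` of the balls against decay `(k+1)^(-(d+2))` leaves `(k+1)^(-2)`, which is
summable; this is why the weight has exponent `d + 2`. -/
theorem lintegral_decayWeight_le {μ : Measure (Euc d)} {n : ℤ} {x : Euc d} {M : ℝ≥0∞}
    (h : ∀ k : ℕ, μ (Metric.ball x (((k : ℝ) + 1) * 2 ^ (-n)))
      ≤ M * ENNReal.ofReal (((k : ℝ) + 1) ^ d)) :
    ∫⁻ y, ENNReal.ofReal (decayWeight n (x - y)) ∂μ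
      ≤ ENNReal.ofReal (((2 : ℝ) ^ n) ^ d) * M * inverseSquareSum := by
  refine (lintegral_decayWeight_le_tsum μ n x).trans ?_
  rw [inverseSquareSum, ← ENNReal.tsum_mul_left]
  refine ENNReal.tsum_le_tsum fun k => ?_
  calc _ ≤ ENNReal.ofReal (((2 : ℝ) ^ n) ^ d / ((k : ℝ) + 1) ^ (d + 2)) *
        (M * ENNReal.ofReal (((k : ℝ) + 1) ^ d)) := by gcongr; exact h k
    _ = M * (ENNReal.ofReal (((2 : ℝ) ^ n) ^ d / ((k : ℝ) + 1) ^ (d + 2)) *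
        ENNReal.ofReal (((k : ℝ) + 1) ^ d)) := by ring
    _ = M * (ENNReal.ofReal (((2 : ℝ) ^ n) ^ d) * ENNReal.ofReal (1 / ((k : ℝ) + 1) ^ 2)) := by
        rw [← ENNReal.ofReal_mul (by positivity), ← ENNReal.ofReal_mul (by positivity)]
        congr 2
        field_simp
        ring
    _ = _ := by ring

/-- A bound for the mass of `decayWeight n` which does not depend on `n`. -/
noncomputable def weightMass (d : ℕ) : ℝ≥0∞ :=
  volume (Metric.ball (0 : Euc d) 1) * inverseSquareSum

theorem weightMass_ne_top : weightMass d ≠ ⊤ :=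
  ENNReal.mul_ne_top measure_ball_lt_top.ne inverseSquareSum_ne_top

theorem volume_ball_eq (x : Euc d) {r : ℝ} (hr : 0 < r) : volume (Metric.ball x r)
    = ENNReal.ofReal (r ^ d) * volume (Metric.ball (0 : Euc d) 1) := by
  rw [Measure.addHaar_ball_of_pos _ _ hr, finrank_euclideanSpace_fin]

theorem lintegral_decayWeight_volume_le (n : ℤ) (x : Euc d) :
    ∫⁻ y, ENNReal.ofReal (decayWeight n (x - y)) ≤ weightMass d := by
  refine (lintegral_decayWeight_le (M := ENNReal.ofReal (((2 : ℝ) ^ (-n)) ^ d) *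
    volume (Metric.ball (0 : Euc d) 1)) fun k => ?_).trans (le_of_eq ?_)
  · rw [volume_ball_eq _ (by positivity), mul_pow, ENNReal.ofReal_mul (by positivity)]
    exact le_of_eq (by ring)
  · rw [weightMass, ← mul_assoc (ENNReal.ofReal _), ← ENNReal.ofReal_mul (by positivity), ← mul_pow,
      ← zpow_add₀ two_ne_zero]
    simp

/-- The weighted average of `‖f‖` around `x` at scale `2 ^ (-n)`. -/
noncomputable def weightedAverage (n : ℤ) (f : Euc d → ℂ) (x : Euc d) : ℝ≥0∞ :=
  ∫⁻ y, ENNReal.ofReal (decayWeight n (x - y)) * ‖f y‖ₑ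

theorem measurable_decayWeight_sub (n : ℤ) : Measurable
    (Function.uncurry fun x y : Euc d => ENNReal.ofReal (decayWeight n (x - y))) :=
  ENNReal.measurable_ofReal.comp
    ((continuous_decayWeight n).comp (continuous_fst.sub continuous_snd)).measurable

theorem eLpNorm_weightedAverage_le {μ : Measure (Euc d)} [SFinite μ] {n : ℤ} {f : Euc d → ℂ}
    (hf : AEStronglyMeasurable f volume) {B : ℝ≥0∞}
    (hB : ∀ y, ∫⁻ x, ENNReal.ofReal (decayWeight n (y - x)) ∂μ ≤ B) {p : ℝ≥0∞} (hp : 1 ≤ p) :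
    eLpNorm (weightedAverage n f) p μ
      ≤ weightMass d ^ (1 - 1 / p.toReal) * B ^ (1 / p.toReal) * eLpNorm f p volume := by
  have := eLpNorm_lintegral_mul_le (μ := μ) (lam := volume) (measurable_decayWeight_sub n)
    hf.enorm (A := weightMass d) (B := B) (fun x => lintegral_decayWeight_volume_le n x)
    (fun y => by
      refine le_trans (le_of_eq (lintegral_congr fun x => ?_)) (hB y)
      rw [← decayWeight_neg, neg_sub]) hp
  rwa [eLpNorm_enorm] at this

theorem eLpNorm_weightedAverage_volume_le {n : ℤ} {f : Euc d → ℂ}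
    (hf : AEStronglyMeasurable f volume) {p : ℝ≥0∞} (hp : 1 ≤ p) :
    eLpNorm (weightedAverage n f) p volume ≤ weightMass d * eLpNorm f p volume := by
  refine (eLpNorm_weightedAverage_le hf (fun y => lintegral_decayWeight_volume_le n y) hp).trans ?_
  have hq := one_div_toReal_le_one hp
  rw [← ENNReal.rpow_add_of_nonneg _ _ (by linarith) (by positivity), sub_add_cancel,
    ENNReal.rpow_one]

theorem exists_weightedAverage_le (n : ℤ) {f : Euc d → ℂ} {p : ℝ≥0∞} (hf : MemLp f p volume)
    (hp : 1 ≤ p) : ∃ M : ℝ≥0∞, M ≠ ⊤ ∧ ∀ x, weightedAverage n f x ≤ M := by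
  have hq := one_div_toReal_le_one hp
  refine ⟨weightMass d ^ (1 - 1 / p.toReal) * ENNReal.ofReal (((2 : ℝ) ^ n) ^ d) ^ (1 / p.toReal) *
    eLpNorm f p volume, ?_, fun x => ?_⟩
  · refine ENNReal.mul_ne_top (ENNReal.mul_ne_top ?_ ?_) hf.2.ne
    · exact ENNReal.rpow_ne_top_of_nonneg (by linarith) weightMass_ne_top
    · exact ENNReal.rpow_ne_top_of_nonneg (by positivity) ENNReal.ofReal_ne_top
  -- Schur's test into the Dirac mass at `x` is a pointwise bound, uniform in `x`, since the weight
  -- is bounded by `2^(nd)`.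
  · have h := eLpNorm_weightedAverage_le (μ := Measure.dirac x) (n := n)
      (B := ENNReal.ofReal (((2 : ℝ) ^ n) ^ d)) hf.1
      (fun y => by rw [lintegral_dirac]; exact ENNReal.ofReal_le_ofReal (decayWeight_le _ _)) hp
    rwa [eLpNorm_dirac _ _ (zero_lt_one.trans_le hp).ne', enorm_eq_self] at h

theorem weightedAverage_lt_top (n : ℤ) {f : Euc d → ℂ} {p : ℝ≥0∞} (hf : MemLp f p volume)
    (hp : 1 ≤ p) (x : Euc d) : weightedAverage n f x < ⊤ := by
  obtain ⟨M, hM, h⟩ := exists_weightedAverage_le n hf hp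
  exact (h x).trans_lt hM.lt_top

end Weight

/-! ### The low-pass filters on `L^p` -/

section LowPass

variable {d : ℕ} {ρ : Euc d → ℝ}

/-- The constant in the decay estimates for the low-pass kernels. -/
noncomputable def decayConst (hρ : IsDyadicPartition ρ) : ℝ :=
  (exists_lowPassKernel_decay hρ).choose

theorem decayConst_pos (hρ : IsDyadicPartition ρ) : 0 < decayConst hρ :=
  (exists_lowPassKernel_decay hρ).choose_spec.1

theorem enorm_lowPassKernel_le (hρ : IsDyadicPartition ρ) (n : ℤ) (z : Euc d) :
    ‖lowPassKernel hρ n z‖ₑ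
      ≤ ENNReal.ofReal (decayConst hρ) * ENNReal.ofReal (decayWeight n z) := by
  rw [← ENNReal.ofReal_mul (decayConst_pos hρ).le, ← ofReal_norm]
  exact ENNReal.ofReal_le_ofReal ((exists_lowPassKernel_decay hρ).choose_spec.2.1 n z)

theorem enorm_lowPassKernel_sub_le (hρ : IsDyadicPartition ρ) (n : ℤ) (u v : Euc d)
    (h : 2 ^ n * ‖u - v‖ ≤ 1) : ‖lowPassKernel hρ n u - lowPassKernel hρ n v‖ₑ
      ≤ ENNReal.ofReal (decayConst hρ * (2 ^ n * ‖u - v‖)) * ENNReal.ofReal (decayWeight n u) := by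
  rw [← ENNReal.ofReal_mul (mul_nonneg (decayConst_pos hρ).le (by positivity)),
    ← ofReal_norm]
  exact ENNReal.ofReal_le_ofReal ((exists_lowPassKernel_decay hρ).choose_spec.2.2 n u v h)

/-- The low-pass filter at frequency `2 ^ n`. -/
noncomputable def lowPass (hρ : IsDyadicPartition ρ) (n : ℤ) (f : Euc d → ℂ) (x : Euc d) : ℂ :=
  ∫ y, lowPassKernel hρ n (x - y) * f y

theorem lintegral_enorm_lowPassKernel_mul_le (hρ : IsDyadicPartition ρ) (n : ℤ) (f : Euc d → ℂ)
    (x : Euc d) : ∫⁻ y, ‖lowPassKernel hρ n (x - y) * f y‖ₑ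
      ≤ ENNReal.ofReal (decayConst hρ) * weightedAverage n f x := by
  rw [weightedAverage, ← lintegral_const_mul' _ _ ENNReal.ofReal_ne_top]
  refine lintegral_mono fun y => ?_
  rw [enorm_mul, ← mul_assoc]
  gcongr
  exact enorm_lowPassKernel_le hρ n _

theorem enorm_lowPass_le (hρ : IsDyadicPartition ρ) (n : ℤ) (f : Euc d → ℂ) (x : Euc d) :
    ‖lowPass hρ n f x‖ₑ ≤ ENNReal.ofReal (decayConst hρ) * weightedAverage n f x :=
  (enorm_integral_le_lintegral_enorm _).trans (lintegral_enorm_lowPassKernel_mul_le hρ n f x)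

variable {p : ℝ≥0∞} {f g : Euc d → ℂ}

theorem integrable_lowPassKernel_mul (hρ : IsDyadicPartition ρ) (n : ℤ) (hf : MemLp f p volume)
    (hp : 1 ≤ p) (x : Euc d) : Integrable fun y => lowPassKernel hρ n (x - y) * f y := by
  refine ⟨?_, (lintegral_enorm_lowPassKernel_mul_le hρ n f x).trans_lt
    (ENNReal.mul_lt_top ENNReal.ofReal_lt_top (weightedAverage_lt_top n hf hp x))⟩
  exact ((lowPassKernel hρ n).continuous.comp
    (continuous_const.sub continuous_id)).aestronglyMeasurable.mul hf.1

theorem lowPass_sub (hρ : IsDyadicPartition ρ) (n : ℤ) (hf : MemLp f p volume)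
    (hg : MemLp g p volume) (hp : 1 ≤ p) :
    lowPass hρ n (f - g) = lowPass hρ n f - lowPass hρ n g := by
  ext x
  simp only [lowPass, Pi.sub_apply, mul_sub]
  exact integral_sub (integrable_lowPassKernel_mul hρ n hf hp x)
    (integrable_lowPassKernel_mul hρ n hg hp x)

theorem dyadicBlock_eq (hρ : IsDyadicPartition ρ) (j : ℤ) (hf : MemLp f p volume) (hp : 1 ≤ p) :
    dyadicBlock ρ j f = lowPass hρ j f - lowPass hρ (j - 1) f := by
  ext x
  simp only [dyadicBlock, lowPass, Pi.sub_apply, dyadicKernel_eq hρ, sub_mul]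
  exact integral_sub (integrable_lowPassKernel_mul hρ j hf hp x)
    (integrable_lowPassKernel_mul hρ (j - 1) hf hp x)

/-- Kernel regularity under the integral. The error involves the weighted average at `x` only, not
at `a`, so it can later be integrated over the pieces and controlled by Lebesgue measure. -/
theorem enorm_lowPass_sub_le (hρ : IsDyadicPartition ρ) (n : ℤ) (hf : MemLp f p volume)
    (hp : 1 ≤ p) (x a : Euc d) {t : ℝ} (h : 2 ^ n * ‖x - a‖ ≤ t) (ht : t ≤ 1) :
    ‖lowPass hρ n f x - lowPass hρ n f a‖ₑ
      ≤ ENNReal.ofReal (decayConst hρ * t) * weightedAverage n f x := by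
  rw [lowPass, lowPass, ← integral_sub (integrable_lowPassKernel_mul hρ n hf hp x)
    (integrable_lowPassKernel_mul hρ n hf hp a)]
  refine (enorm_integral_le_lintegral_enorm _).trans ?_
  rw [weightedAverage, ← lintegral_const_mul' _ _ ENNReal.ofReal_ne_top]
  refine lintegral_mono fun y => ?_
  rw [← sub_mul, enorm_mul, ← mul_assoc]
  gcongr
  have he : x - y - (a - y) = x - a := sub_sub_sub_cancel_right _ _ _
  refine (enorm_lowPassKernel_sub_le hρ n (x - y) (a - y) (by rw [he]; linarith)).trans ?_
  rw [he]
  gcongr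
  exact (decayConst_pos hρ).le

theorem continuous_lowPass (hρ : IsDyadicPartition ρ) (n : ℤ) (hf : MemLp f p volume)
    (hp : 1 ≤ p) : Continuous (lowPass hρ n f) := by
  rw [continuous_iff_continuousAt]
  intro x
  rw [ContinuousAt, tendsto_iff_edist_tendsto_0]
  have hc : Continuous fun a : Euc d => 2 ^ n * ‖x - a‖ := by fun_prop
  have h0 : Tendsto (fun a : Euc d => ENNReal.ofReal (decayConst hρ * (2 ^ n * ‖x - a‖)) *
      weightedAverage n f x) (𝓝 x) (𝓝 0) := by
    have h1 : Tendsto (fun a : Euc d => ENNReal.ofReal (decayConst hρ * (2 ^ n * ‖x - a‖)))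
        (𝓝 x) (𝓝 0) := by
      have hc' : Continuous fun a : Euc d =>
          ENNReal.ofReal (decayConst hρ * (2 ^ n * ‖x - a‖)) :=
        ENNReal.continuous_ofReal.comp (hc.const_mul _)
      simpa using hc'.tendsto x
    simpa using ENNReal.Tendsto.mul_const h1 (Or.inr (weightedAverage_lt_top n hf hp x).ne)
  refine tendsto_of_tendsto_of_tendsto_of_le_of_le' tendsto_const_nhds h0
    (Eventually.of_forall fun _ => zero_le) ?_
  filter_upwards [hc.continuousAt.eventually_lt_const
    (show 2 ^ n * ‖x - x‖ < 1 by simp)] with a ha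
  rw [edist_comm, edist_eq_enorm_sub]
  exact enorm_lowPass_sub_le hρ n hf hp x a le_rfl ha.le

theorem eLpNorm_lowPass_le {μ : Measure (Euc d)} (hρ : IsDyadicPartition ρ) (n : ℤ)
    (f : Euc d → ℂ) (p : ℝ≥0∞) : eLpNorm (lowPass hρ n f) p μ
      ≤ ENNReal.ofReal (decayConst hρ) * eLpNorm (weightedAverage n f) p μ := by
  have h := eLpNorm_le_nnreal_smul_eLpNorm_of_ae_le_mul' (μ := μ) (f := lowPass hρ n f)
    (g := weightedAverage n f) (c := (decayConst hρ).toNNReal)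
    (Eventually.of_forall fun x => enorm_lowPass_le hρ n f x) p
  exact h

theorem eLpNorm_lowPass_volume_le (hρ : IsDyadicPartition ρ) (n : ℤ)
    (hf : AEStronglyMeasurable f volume) (hp : 1 ≤ p) : eLpNorm (lowPass hρ n f) p volume
      ≤ ENNReal.ofReal (decayConst hρ) * weightMass d * eLpNorm f p volume := by
  refine (eLpNorm_lowPass_le hρ n f p).trans ?_
  rw [mul_assoc]
  gcongr
  exact eLpNorm_weightedAverage_volume_le hf hp

theorem memLp_lowPass (hρ : IsDyadicPartition ρ) (n : ℤ) (hf : MemLp f p volume) (hp : 1 ≤ p) :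
    MemLp (lowPass hρ n f) p volume :=
  ⟨(continuous_lowPass hρ n hf hp).aestronglyMeasurable,
    (eLpNorm_lowPass_volume_le hρ n hf.1 hp).trans_lt (ENNReal.mul_lt_top
      (ENNReal.mul_lt_top ENNReal.ofReal_lt_top weightMass_ne_top.lt_top) hf.2)⟩

theorem lowPass_lowPass_eq_integral (hρ : IsDyadicPartition ρ) (n k : ℤ) (hf : MemLp f p volume)
    (hp : 1 ≤ p) (x : Euc d) : lowPass hρ n (lowPass hρ k f) x
      = ∫ z, (∫ y, lowPassKernel hρ n (x - y) * lowPassKernel hρ k (y - z)) * f z := by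
  have hmeas : AEStronglyMeasurable (Function.uncurry fun y z : Euc d =>
      lowPassKernel hρ n (x - y) * (lowPassKernel hρ k (y - z) * f z))
      (volume.prod volume) := by
    refine AEStronglyMeasurable.mul ?_ (AEStronglyMeasurable.mul ?_ hf.1.comp_snd)
    · exact ((lowPassKernel hρ n).continuous.comp
        (continuous_const.sub continuous_fst)).aestronglyMeasurable
    · exact ((lowPassKernel hρ k).continuous.comp
        (continuous_fst.sub continuous_snd)).aestronglyMeasurable
  have hint : Integrable (Function.uncurry fun y z : Euc d =>
      lowPassKernel hρ n (x - y) * (lowPassKernel hρ k (y - z) * f z))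
      (volume.prod volume) := by
    refine ⟨hmeas, ?_⟩
    -- Absolute integrability for Fubini: the inner integral is bounded uniformly in `y`, and the
    -- outer kernel has finite mass.
    obtain ⟨M, hM, hle⟩ := exists_weightedAverage_le k hf hp
    rw [HasFiniteIntegral, lintegral_prod _ hmeas.enorm]
    refine lt_of_le_of_lt (b := ∫⁻ y, (ENNReal.ofReal (decayConst hρ) *
      ENNReal.ofReal (decayWeight n (x - y))) * (ENNReal.ofReal (decayConst hρ) * M))
      (lintegral_mono fun y => ?_) ?_
    · simp only [Function.uncurry_apply_pair]
      simp_rw [enorm_mul (lowPassKernel hρ n (x - y))]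
      rw [lintegral_const_mul' _ _ enorm_ne_top]
      gcongr
      · exact enorm_lowPassKernel_le hρ n _
      · refine (lintegral_enorm_lowPassKernel_mul_le hρ k f y).trans ?_
        gcongr
        exact hle y
    · rw [lintegral_mul_const' _ _ (ENNReal.mul_ne_top ENNReal.ofReal_ne_top hM),
        lintegral_const_mul' _ _ ENNReal.ofReal_ne_top]
      exact ENNReal.mul_lt_top (ENNReal.mul_lt_top ENNReal.ofReal_lt_top
        ((lintegral_decayWeight_volume_le n x).trans_lt weightMass_ne_top.lt_top))
        (ENNReal.mul_lt_top ENNReal.ofReal_lt_top hM.lt_top)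
  calc lowPass hρ n (lowPass hρ k f) x
      = ∫ y, ∫ z, lowPassKernel hρ n (x - y) * (lowPassKernel hρ k (y - z) * f z) := by
        refine integral_congr_ae (Eventually.of_forall fun y => ?_)
        exact (integral_const_mul _ _).symm
    _ = ∫ z, ∫ y, lowPassKernel hρ n (x - y) * (lowPassKernel hρ k (y - z) * f z) :=
        integral_integral_swap hint
    _ = _ := by
        refine integral_congr_ae (Eventually.of_forall fun z => ?_)
        simp_rw [← mul_assoc]
        exact integral_mul_const _ _

theorem lowPass_lowPass_of_lt (hρ : IsDyadicPartition ρ) {n k : ℤ} (h : k < n)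
    (hf : MemLp f p volume) (hp : 1 ≤ p) : lowPass hρ n (lowPass hρ k f) = lowPass hρ k f := by
  ext x
  simp_rw [lowPass_lowPass_eq_integral hρ n k hf hp x, integral_lowPassKernel_mul hρ h]
  rfl

theorem lowPass_lowPass_of_gt (hρ : IsDyadicPartition ρ) {n k : ℤ} (h : n < k)
    (hf : MemLp f p volume) (hp : 1 ≤ p) : lowPass hρ n (lowPass hρ k f) = lowPass hρ n f := by
  ext x
  rw [lowPass_lowPass_eq_integral hρ n k hf hp x]
  have hz : ∀ z, ∫ y, lowPassKernel hρ n (x - y) * lowPassKernel hρ k (y - z)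
      = lowPassKernel hρ n (x - z) := by
    intro z
    -- The reflection `y ↦ x + z - y` exchanges the roles of the two kernels, reducing to the case
    -- already known.
    rw [← integral_lowPassKernel_mul hρ h x z, ← integral_sub_left_eq_self _ volume (x + z)]
    refine integral_congr_ae (Eventually.of_forall fun y => ?_)
    simp only
    rw [mul_comm, show x + z - y - z = x - y by abel, show x - (x + z - y) = y - z by abel]
  simp_rw [hz]
  rfl

theorem lowPass_comm (hρ : IsDyadicPartition ρ) (n k : ℤ) (hf : MemLp f p volume) (hp : 1 ≤ p) :
    lowPass hρ n (lowPass hρ k f) = lowPass hρ k (lowPass hρ n f) := by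
  rcases lt_trichotomy n k with h | rfl | h
  · rw [lowPass_lowPass_of_gt hρ h hf hp, lowPass_lowPass_of_lt hρ h hf hp]
  · rfl
  · rw [lowPass_lowPass_of_lt hρ h hf hp, lowPass_lowPass_of_gt hρ h hf hp]

end LowPass

/-! ### Convergence of the filters at Lebesgue points -/

section Approximation

variable {d : ℕ} {ρ : Euc d → ℝ} {p : ℝ≥0∞} {f : Euc d → ℂ}

/-- The mean oscillation of `f` around the value `f x` over the ball of radius `r`. -/
noncomputable def meanOscillation (f : Euc d → ℂ) (x : Euc d) (r : ℝ) : ℝ≥0∞ :=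
  (∫⁻ y in Metric.closedBall x r, ‖f y - f x‖ₑ) / volume (Metric.closedBall x r)

theorem ae_tendsto_meanOscillation (hf : LocallyIntegrable f volume) :
    ∀ᵐ x, Tendsto (meanOscillation f x) (𝓝[>] 0) (𝓝 0) := by
  filter_upwards [(Besicovitch.vitaliFamily (volume : Measure (Euc d))).ae_tendsto_lintegral_enorm_sub_div
    hf] with x hx
  exact hx.comp (Besicovitch.tendsto_filterAt volume x)

theorem volume_closedBall_ne_zero (x : Euc d) {r : ℝ} (hr : 0 < r) :
    volume (Metric.closedBall x r) ≠ 0 :=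
  (Metric.measure_closedBall_pos volume x hr).ne'

theorem tendsto_meanOscillation_of_continuousAt {x : Euc d} (hf : ContinuousAt f x) :
    Tendsto (meanOscillation f x) (𝓝[>] 0) (𝓝 0) := by
  rw [ENNReal.tendsto_nhds_zero]
  intro ε hε
  have h1 : ∀ᶠ y in 𝓝 x, ‖f y - f x‖ₑ ≤ ε := by
    have := (tendsto_iff_edist_tendsto_0.1 hf)
    rw [ENNReal.tendsto_nhds_zero] at this
    simpa [edist_eq_enorm_sub] using this ε hε
  obtain ⟨r₀, hr₀, h2⟩ := Metric.eventually_nhds_iff_ball.1 h1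
  filter_upwards [Ioo_mem_nhdsGT hr₀] with r hr
  refine ENNReal.div_le_of_le_mul ?_
  calc _ ≤ ∫⁻ _ in Metric.closedBall x r, ε := by
        refine setLIntegral_mono' Metric.isClosed_closedBall.measurableSet fun y hy => ?_
        exact h2 y (lt_of_le_of_lt hy hr.2)
    _ = _ := by rw [setLIntegral_const]

theorem setLIntegral_enorm_le_mul_rpow (hf : MemLp f p volume) (hp : 1 ≤ p) (s : Set (Euc d)) :
    ∫⁻ y in s, ‖f y‖ₑ ≤ eLpNorm f p volume * volume s ^ (1 - 1 / p.toReal) := by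
  rw [← eLpNorm_one_eq_lintegral_enorm]
  refine (eLpNorm_le_eLpNorm_mul_rpow_measure_univ hp hf.1.restrict).trans ?_
  rw [Measure.restrict_apply_univ, ENNReal.toReal_one, div_one]
  gcongr
  exact Measure.restrict_le_self

/-- Small radii are controlled by the limit, large ones by Hölder's inequality and the size of `f
x`. The uniform bound serves as the dominating function below. -/
theorem exists_meanOscillation_le (hf : MemLp f p volume) (hp : 1 ≤ p) {x : Euc d}
    (hx : Tendsto (meanOscillation f x) (𝓝[>] 0) (𝓝 0)) :
    ∃ M : ℝ≥0∞, M ≠ ⊤ ∧ ∀ r, 0 < r → meanOscillation f x r ≤ M := by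
  have h1 := hx.eventually (eventually_le_nhds (show (0 : ℝ≥0∞) < 1 from zero_lt_one))
  obtain ⟨r₀, hr₀, h2⟩ := mem_nhdsGT_iff_exists_Ioc_subset.1 h1
  have hq := one_div_toReal_le_one hp
  set s := 1 / p.toReal
  have hs : 0 ≤ s := by positivity
  set v₀ := volume (Metric.closedBall x r₀)
  have hv₀ : v₀ ≠ 0 := volume_closedBall_ne_zero x hr₀
  refine ⟨1 + (eLpNorm f p volume * (v₀ ^ s)⁻¹ + ‖f x‖ₑ), ?_, fun r hr => ?_⟩
  · refine ENNReal.add_ne_top.2 ⟨ENNReal.one_ne_top, ENNReal.add_ne_top.2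
      ⟨ENNReal.mul_ne_top hf.2.ne (ENNReal.inv_ne_top.2 ?_), enorm_ne_top⟩⟩
    exact (ENNReal.rpow_pos (pos_iff_ne_zero.2 hv₀) measure_closedBall_lt_top.ne).ne'
  rcases le_or_gt r r₀ with hle | hlt
  · exact le_add_right (h2 ⟨hr, hle⟩)
  refine le_add_left ?_
  set v := volume (Metric.closedBall x r)
  have hv : v ≠ 0 := volume_closedBall_ne_zero x hr
  have hvt : v ≠ ⊤ := measure_closedBall_lt_top.ne
  refine ENNReal.div_le_of_le_mul ?_
  calc ∫⁻ y in Metric.closedBall x r, ‖f y - f x‖ₑ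
      ≤ ∫⁻ y in Metric.closedBall x r, (‖f y‖ₑ + ‖f x‖ₑ) := lintegral_mono fun y => enorm_sub_le
    _ = (∫⁻ y in Metric.closedBall x r, ‖f y‖ₑ) + ‖f x‖ₑ * v := by
        rw [lintegral_add_right _ measurable_const, setLIntegral_const]
    _ ≤ eLpNorm f p volume * v ^ (1 - s) + ‖f x‖ₑ * v := by
        gcongr
        exact setLIntegral_enorm_le_mul_rpow hf hp _
    _ = (eLpNorm f p volume * (v ^ s)⁻¹ + ‖f x‖ₑ) * v := by
        rw [ENNReal.rpow_sub _ _ hv hvt, ENNReal.rpow_one, div_eq_mul_inv]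
        ring
    _ ≤ _ := by
        gcongr
        exact measure_mono (Metric.closedBall_subset_closedBall hlt.le)

/-- The decomposition into balls, applied to the measure with density `‖f - f x‖`. -/
theorem lintegral_decayWeight_mul_enorm_sub_le (hf : AEStronglyMeasurable f volume) (n : ℤ)
    (x : Euc d) : ∫⁻ y, ENNReal.ofReal (decayWeight n (x - y)) * ‖f y - f x‖ₑ
      ≤ ∑' k : ℕ, ENNReal.ofReal (1 / ((k : ℝ) + 1) ^ 2) * volume (Metric.ball (0 : Euc d) 1) *
        meanOscillation f x (((k : ℝ) + 1) * 2 ^ (-n)) := by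
  have hm : AEMeasurable (fun y => ‖f y - f x‖ₑ) volume :=
    (hf.sub aestronglyMeasurable_const).enorm
  have hw : AEMeasurable (fun y => ENNReal.ofReal (decayWeight n (x - y))) volume :=
    ((measurable_decayWeight_sub n).comp measurable_prodMk_left).aemeasurable
  have h := lintegral_decayWeight_le_tsum (volume.withDensity fun y => ‖f y - f x‖ₑ) n x
  rw [lintegral_withDensity_eq_lintegral_mul₀ hm hw] at h
  simp only [Pi.mul_apply] at h
  simp_rw [mul_comm (‖f _ - f x‖ₑ)] at h
  refine h.trans (ENNReal.tsum_le_tsum fun k => ?_)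
  set r := ((k : ℝ) + 1) * 2 ^ (-n) with hr
  have hr0 : 0 < r := by positivity
  have hv : volume (Metric.closedBall x r) ≠ 0 := volume_closedBall_ne_zero x hr0
  have hvt : volume (Metric.closedBall x r) ≠ ⊤ := measure_closedBall_lt_top.ne
  have hb : volume (Metric.closedBall x r)
      = ENNReal.ofReal (r ^ d) * volume (Metric.ball (0 : Euc d) 1) := by
    rw [Measure.addHaar_closedBall _ _ hr0.le, finrank_euclideanSpace_fin]
  calc _ ≤ ENNReal.ofReal (((2 : ℝ) ^ n) ^ d / ((k : ℝ) + 1) ^ (d + 2)) *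
        (meanOscillation f x r * volume (Metric.closedBall x r)) := by
        gcongr
        rw [withDensity_apply _ measurableSet_ball, meanOscillation, ENNReal.div_mul_cancel hv hvt]
        exact lintegral_mono_set Metric.ball_subset_closedBall
    _ = ENNReal.ofReal (((2 : ℝ) ^ n) ^ d / ((k : ℝ) + 1) ^ (d + 2)) * ENNReal.ofReal (r ^ d) *
        volume (Metric.ball (0 : Euc d) 1) * meanOscillation f x r := by
        rw [hb]
        ring
    _ = _ := by
        rw [← ENNReal.ofReal_mul (by positivity)]
        congr 3
        rw [hr, mul_pow, zpow_neg, inv_pow]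
        field_simp
        ring

theorem tendsto_lintegral_decayWeight_mul_enorm_sub (hf : MemLp f p volume) (hp : 1 ≤ p)
    {x : Euc d} (hx : Tendsto (meanOscillation f x) (𝓝[>] 0) (𝓝 0)) :
    Tendsto (fun n : ℤ => ∫⁻ y, ENNReal.ofReal (decayWeight n (x - y)) * ‖f y - f x‖ₑ)
      atTop (𝓝 0) := by
  obtain ⟨M, hM, hle⟩ := exists_meanOscillation_le hf hp hx
  set V := volume (Metric.ball (0 : Euc d) 1)
  have hV : V ≠ ⊤ := measure_ball_lt_top.ne
  have h2 : Tendsto (fun n : ℤ => (2 : ℝ) ^ (-n)) atTop (𝓝 0) := by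
    have := (tendsto_rpow_atTop_of_base_lt_one (1 / 2) (by norm_num) (by norm_num)).comp
      (tendsto_intCast_atTop_atTop (R := ℝ))
    simpa [Function.comp_def, zpow_neg] using this
  have hlim : Tendsto (fun n : ℤ => ∑' k : ℕ, ENNReal.ofReal (1 / ((k : ℝ) + 1) ^ 2) * V *
        meanOscillation f x (((k : ℝ) + 1) * 2 ^ (-n))) atTop (𝓝 0) := by
    -- Dominated convergence for the series, viewed as an integral against counting measure.
    have hc := tendsto_lintegral_filter_of_dominated_convergence (μ := Measure.count)
      (l := (atTop : Filter ℤ))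
      (F := fun n (k : ℕ) => ENNReal.ofReal (1 / ((k : ℝ) + 1) ^ 2) * V *
        meanOscillation f x (((k : ℝ) + 1) * 2 ^ (-n))) (f := fun _ => 0)
      (fun k => ENNReal.ofReal (1 / ((k : ℝ) + 1) ^ 2) * V * M)
      (Eventually.of_forall fun n => measurable_from_nat)
      (Eventually.of_forall fun n => Eventually.of_forall fun k => by
        gcongr
        exact hle _ (by positivity))
      (by
        rw [lintegral_count, ENNReal.tsum_mul_right, ENNReal.tsum_mul_right]
        exact ENNReal.mul_ne_top (ENNReal.mul_ne_top inverseSquareSum_ne_top hV) hM)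
      (Eventually.of_forall fun k => by
        have h3 : Tendsto (fun n : ℤ => ((k : ℝ) + 1) * 2 ^ (-n)) atTop (𝓝[>] 0) := by
          rw [tendsto_nhdsWithin_iff]
          refine ⟨by simpa using h2.const_mul ((k : ℝ) + 1), Eventually.of_forall fun n => ?_⟩
          exact mem_Ioi.2 (by positivity)
        have := ENNReal.Tendsto.const_mul (a := ENNReal.ofReal (1 / ((k : ℝ) + 1) ^ 2) * V)
          (hx.comp h3) (Or.inr (ENNReal.mul_ne_top ENNReal.ofReal_ne_top hV))
        simpa using this)
    simpa [lintegral_count] using hc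
  exact tendsto_of_tendsto_of_tendsto_of_le_of_le tendsto_const_nhds hlim
    (fun _ => zero_le) fun n => lintegral_decayWeight_mul_enorm_sub_le hf.1 n x

theorem tendsto_lowPass_of_tendsto_meanOscillation (hρ : IsDyadicPartition ρ)
    (hf : MemLp f p volume) (hp : 1 ≤ p) {x : Euc d}
    (hx : Tendsto (meanOscillation f x) (𝓝[>] 0) (𝓝 0)) :
    Tendsto (fun n : ℤ => lowPass hρ n f x) atTop (𝓝 (f x)) := by
  rw [tendsto_iff_edist_tendsto_0]
  have h0 : Tendsto (fun n : ℤ => ENNReal.ofReal (decayConst hρ) *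
      ∫⁻ y, ENNReal.ofReal (decayWeight n (x - y)) * ‖f y - f x‖ₑ) atTop (𝓝 0) := by
    simpa using ENNReal.Tendsto.const_mul (tendsto_lintegral_decayWeight_mul_enorm_sub hf hp hx)
      (Or.inr ENNReal.ofReal_ne_top)
  refine tendsto_of_tendsto_of_tendsto_of_le_of_le tendsto_const_nhds h0 (fun _ => zero_le)
    fun n => ?_
  have hi : Integrable fun y => lowPassKernel hρ n (x - y) :=
    (lowPassKernel hρ n).integrable.comp_sub_left x
  -- The kernel has integral 1, so the constant `f x` goes under the integral.
  have he : lowPass hρ n f x - f x = ∫ y, lowPassKernel hρ n (x - y) * (f y - f x) := by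
    simp_rw [mul_sub]
    rw [integral_sub (integrable_lowPassKernel_mul hρ n hf hp x) (hi.mul_const _),
      integral_mul_const, integral_sub_left_eq_self (fun y => lowPassKernel hρ n y) volume x,
      integral_lowPassKernel, one_mul]
    rfl
  simp only
  rw [edist_eq_enorm_sub, he, ← lintegral_const_mul' _ _ ENNReal.ofReal_ne_top]
  refine (enorm_integral_le_lintegral_enorm _).trans (lintegral_mono fun y => ?_)
  rw [enorm_mul, ← mul_assoc]
  gcongr
  exact enorm_lowPassKernel_le hρ n _

theorem ae_tendsto_lowPass (hρ : IsDyadicPartition ρ) (hf : MemLp f p volume) (hp : 1 ≤ p) :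
    ∀ᵐ x, Tendsto (fun n : ℤ => lowPass hρ n f x) atTop (𝓝 (f x)) := by
  filter_upwards [ae_tendsto_meanOscillation (hf.locallyIntegrable hp)] with x hx
  exact tendsto_lowPass_of_tendsto_meanOscillation hρ hf hp hx

/-- Convergence at every point is what the trace argument needs: a Lebesgue-almost-everywhere
statement gives no information on `G`. -/
theorem tendsto_lowPass_of_continuous (hρ : IsDyadicPartition ρ) (hf : MemLp f p volume)
    (hp : 1 ≤ p) (hc : Continuous f) (x : Euc d) :
    Tendsto (fun n : ℤ => lowPass hρ n f x) atTop (𝓝 (f x)) :=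
  tendsto_lowPass_of_tendsto_meanOscillation hρ hf hp
    (tendsto_meanOscillation_of_continuousAt hc.continuousAt)

end Approximation

/-! ### Dyadic blocks and the Besov seminorm -/

section Besov

variable {d : ℕ} {ρ : Euc d → ℝ} {p : ℝ≥0∞} {f g : Euc d → ℂ}

theorem memLp_dyadicBlock (hρ : IsDyadicPartition ρ) (j : ℤ) (hf : MemLp f p volume)
    (hp : 1 ≤ p) : MemLp (dyadicBlock ρ j f) p volume := by
  rw [dyadicBlock_eq hρ j hf hp]
  exact (memLp_lowPass hρ j hf hp).sub (memLp_lowPass hρ (j - 1) hf hp)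

theorem continuous_dyadicBlock (hρ : IsDyadicPartition ρ) (j : ℤ) (hf : MemLp f p volume)
    (hp : 1 ≤ p) : Continuous (dyadicBlock ρ j f) := by
  rw [dyadicBlock_eq hρ j hf hp]
  exact (continuous_lowPass hρ j hf hp).sub (continuous_lowPass hρ (j - 1) hf hp)

theorem dyadicBlock_sub (hρ : IsDyadicPartition ρ) (j : ℤ) (hf : MemLp f p volume)
    (hg : MemLp g p volume) (hp : 1 ≤ p) :
    dyadicBlock ρ j (f - g) = dyadicBlock ρ j f - dyadicBlock ρ j g := by
  rw [dyadicBlock_eq hρ j (hf.sub hg) hp, dyadicBlock_eq hρ j hf hp, dyadicBlock_eq hρ j hg hp,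
    lowPass_sub hρ j hf hg hp, lowPass_sub hρ (j - 1) hf hg hp]
  abel

/-- The reproducing formula, which lets a kernel estimate act on the block itself. The shift to `j +
1` is needed because the symbol at level `j` is not 1 on the whole support of the block. -/
theorem lowPass_dyadicBlock (hρ : IsDyadicPartition ρ) (j : ℤ) (hf : MemLp f p volume)
    (hp : 1 ≤ p) : lowPass hρ (j + 1) (dyadicBlock ρ j f) = dyadicBlock ρ j f := by
  rw [dyadicBlock_eq hρ j hf hp, lowPass_sub hρ _ (memLp_lowPass hρ j hf hp)
    (memLp_lowPass hρ (j - 1) hf hp) hp, lowPass_lowPass_of_lt hρ (by omega) hf hp,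
    lowPass_lowPass_of_lt hρ (by omega) hf hp]

theorem dyadicBlock_lowPass (hρ : IsDyadicPartition ρ) (j n : ℤ) (hf : MemLp f p volume)
    (hp : 1 ≤ p) : dyadicBlock ρ j (lowPass hρ n f) = lowPass hρ n (dyadicBlock ρ j f) := by
  rw [dyadicBlock_eq hρ j hf hp, dyadicBlock_eq hρ j (memLp_lowPass hρ n hf hp) hp,
    lowPass_sub hρ _ (memLp_lowPass hρ j hf hp) (memLp_lowPass hρ (j - 1) hf hp) hp,
    lowPass_comm hρ n j hf hp, lowPass_comm hρ n (j - 1) hf hp]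

theorem dyadicBlock_lowPass_of_lt (hρ : IsDyadicPartition ρ) {j n : ℤ} (h : j < n)
    (hf : MemLp f p volume) (hp : 1 ≤ p) :
    dyadicBlock ρ j (lowPass hρ n f) = dyadicBlock ρ j f := by
  rw [dyadicBlock_eq hρ j hf hp, dyadicBlock_eq hρ j (memLp_lowPass hρ n hf hp) hp,
    lowPass_lowPass_of_gt hρ h hf hp, lowPass_lowPass_of_gt hρ (by omega) hf hp]

theorem lowPass_sub_lowPass_eq_sum (hρ : IsDyadicPartition ρ) (n : ℤ) (K : ℕ)
    (hf : MemLp f p volume) (hp : 1 ≤ p) : lowPass hρ (n + K) f - lowPass hρ n f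
      = ∑ k ∈ Finset.range K, dyadicBlock ρ (n + k + 1) f := by
  have h := Finset.sum_range_sub (fun k : ℕ => lowPass hρ (n + k) f) K
  simp only [Nat.cast_zero, add_zero] at h
  rw [← h]
  refine Finset.sum_congr rfl fun k _ => ?_
  rw [dyadicBlock_eq hρ _ hf hp, add_sub_cancel_right, Nat.cast_succ, add_assoc]

/-- Fatou's lemma on the telescoping partial sums. The measure is arbitrary, so this serves both
Lebesgue measure and the surface measure on `G`. -/
theorem eLpNorm_sub_lowPass_le_tsum {μ : Measure (Euc d)} (hρ : IsDyadicPartition ρ) (n : ℤ)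
    (hf : MemLp f p volume) (hp : 1 ≤ p)
    (hlim : ∀ᵐ x ∂μ, Tendsto (fun k : ℤ => lowPass hρ k f x) atTop (𝓝 (f x))) :
    eLpNorm (f - lowPass hρ n f) p μ
      ≤ ∑' k : ℕ, eLpNorm (dyadicBlock ρ (n + k + 1) f) p μ := by
  have hfat := Lp.eLpNorm_lim_le_liminf_eLpNorm (μ := μ) (p := p)
    (f := fun K : ℕ => lowPass hρ (n + K) f - lowPass hρ n f)
    (fun K => ((continuous_lowPass hρ _ hf hp).sub
      (continuous_lowPass hρ _ hf hp)).aestronglyMeasurable) (f - lowPass hρ n f) (by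
    filter_upwards [hlim] with x hx
    exact (hx.comp (tendsto_atTop_add_const_left _ n tendsto_natCast_atTop_atTop)).sub_const _)
  refine hfat.trans (liminf_le_of_frequently_le' (Eventually.of_forall fun K => ?_).frequently)
  rw [lowPass_sub_lowPass_eq_sum hρ n K hf hp]
  refine (eLpNorm_sum_le (fun k _ =>
    (continuous_dyadicBlock hρ _ hf hp).aestronglyMeasurable) hp).trans ?_
  exact ENNReal.sum_le_tsum _

/-- The `j`-th term of the homogeneous Besov norm. -/
noncomputable def besovTerm (ρ : Euc d → ℝ) (s : ℝ) (p : ℝ≥0∞) (f : Euc d → ℂ) (j : ℤ) : ℝ≥0∞ :=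
  ENNReal.ofReal ((2 : ℝ) ^ ((j : ℝ) * s)) * eLpNorm (dyadicBlock ρ j f) p volume

variable {s : ℝ}

theorem tsum_besovTerm_add_le (n : ℤ) :
    ∑' k : ℕ, besovTerm ρ s p f (n + k) ≤ besovSeminorm ρ s p f :=
  ENNReal.tsum_comp_le_tsum_of_injective (f := fun k : ℕ => n + (k : ℤ))
    (fun a b h => by simpa using h) (besovTerm ρ s p f)

theorem tendsto_tsum_besovTerm (n : ℤ) (h : besovSeminorm ρ s p f < ⊤) :
    Tendsto (fun K : ℕ => ∑' k : ℕ, besovTerm ρ s p f (n + K + k)) atTop (𝓝 0) := by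
  have := ENNReal.tendsto_sum_nat_add (fun k : ℕ => besovTerm ρ s p f (n + k))
    ((tsum_besovTerm_add_le n).trans_lt h).ne
  refine this.congr fun K => tsum_congr fun k => ?_
  congr 1
  push_cast
  ring

theorem eLpNorm_sub_lowPass_volume_le (hρ : IsDyadicPartition ρ) (n : ℤ)
    (hf : MemLp f p volume) (hp : 1 ≤ p) (hs : 0 ≤ s) : eLpNorm (f - lowPass hρ n f) p volume
      ≤ ENNReal.ofReal ((2 : ℝ) ^ (-(n : ℝ) * s)) * ∑' k : ℕ, besovTerm ρ s p f (n + k) := by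
  refine (eLpNorm_sub_lowPass_le_tsum hρ n hf hp (ae_tendsto_lowPass hρ hf hp)).trans ?_
  have hstep : ∑' k : ℕ, besovTerm ρ s p f (n + (k + 1 : ℕ))
      ≤ ∑' k : ℕ, besovTerm ρ s p f (n + k) :=
    ENNReal.tsum_comp_le_tsum_of_injective (add_left_injective 1) fun k : ℕ =>
      besovTerm ρ s p f (n + k)
  refine le_trans ?_ (mul_le_mul_right hstep _)
  rw [← ENNReal.tsum_mul_left]
  refine ENNReal.tsum_le_tsum fun k => ?_
  rw [besovTerm, ← mul_assoc, ← ENNReal.ofReal_mul (by positivity), ← Real.rpow_add two_pos]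
  have h1 : (1 : ℝ≥0∞) ≤ ENNReal.ofReal
      ((2 : ℝ) ^ (-(n : ℝ) * s + ((n + (k + 1 : ℕ) : ℤ) : ℝ) * s)) := by
    rw [ENNReal.one_le_ofReal]
    apply Real.one_le_rpow one_le_two
    push_cast
    have : 0 ≤ ((k : ℝ) + 1) * s := by positivity
    linarith
  rw [show n + (k : ℤ) + 1 = n + (k + 1 : ℕ) by push_cast; ring]
  exact le_mul_of_one_le_left' h1

theorem besovSeminorm_lowPass_le (hρ : IsDyadicPartition ρ) (n : ℤ) (hf : MemLp f p volume)
    (hp : 1 ≤ p) : besovSeminorm ρ s p (lowPass hρ n f)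
      ≤ ENNReal.ofReal (decayConst hρ) * weightMass d * besovSeminorm ρ s p f := by
  rw [besovSeminorm, besovSeminorm, ← ENNReal.tsum_mul_left]
  refine ENNReal.tsum_le_tsum fun j => ?_
  rw [dyadicBlock_lowPass hρ j n hf hp, mul_left_comm]
  gcongr
  exact eLpNorm_lowPass_volume_le hρ n (memLp_dyadicBlock hρ j hf hp).1 hp

/-- Blocks with `j < n` do not see the filter, so only the tail of the seminorm survives; it tends
to 0 with `n → ∞` when the seminorm is finite. -/
theorem besovSeminorm_lowPass_sub_le (hρ : IsDyadicPartition ρ) (n : ℤ) (hf : MemLp f p volume)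
    (hp : 1 ≤ p) : besovSeminorm ρ s p (lowPass hρ n f - f)
      ≤ (ENNReal.ofReal (decayConst hρ) * weightMass d + 1) *
        ∑' k : ℕ, besovTerm ρ s p f (n + k) := by
  have hb := fun j => dyadicBlock_sub hρ j (memLp_lowPass hρ n hf hp) hf hp
  have hsupp : Function.support (besovTerm ρ s p (lowPass hρ n f - f))
      ⊆ range fun k : ℕ => n + (k : ℤ) := by
    intro j hj
    by_contra hjn
    refine hj ?_
    have hlt : j < n := by
      by_contra hge
      exact hjn ⟨(j - n).toNat, by simp only; omega⟩
    simp [besovTerm, hb, dyadicBlock_lowPass_of_lt hρ hlt hf hp]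
  have hinj : Function.Injective fun k : ℕ => n + (k : ℤ) := fun a b h => by simpa using h
  change ∑' j, besovTerm ρ s p (lowPass hρ n f - f) j ≤ _
  rw [← hinj.tsum_eq hsupp, ← ENNReal.tsum_mul_left]
  refine ENNReal.tsum_le_tsum fun k => ?_
  rw [besovTerm, besovTerm, hb, dyadicBlock_lowPass hρ _ n hf hp, mul_left_comm]
  gcongr
  have hm := memLp_dyadicBlock hρ (n + k) hf hp
  refine (eLpNorm_sub_le (memLp_lowPass hρ n hm hp).1 hm.1 hp).trans ?_
  rw [add_mul, one_mul]
  gcongr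
  exact eLpNorm_lowPass_volume_le hρ n hm.1 hp

theorem besovSeminorm_le_add (hρ : IsDyadicPartition ρ) (hf : MemLp f p volume)
    (hg : MemLp g p volume) (hp : 1 ≤ p) :
    besovSeminorm ρ s p g ≤ besovSeminorm ρ s p f + besovSeminorm ρ s p (g - f) := by
  rw [besovSeminorm, besovSeminorm, besovSeminorm, ← ENNReal.tsum_add]
  refine ENNReal.tsum_le_tsum fun j => ?_
  rw [← mul_add]
  gcongr
  have h : dyadicBlock ρ j g = dyadicBlock ρ j f + dyadicBlock ρ j (g - f) := by
    rw [dyadicBlock_sub hρ j hg hf hp]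
    abel
  rw [h]
  exact eLpNorm_add_le (memLp_dyadicBlock hρ j hf hp).1
    (memLp_dyadicBlock hρ j (hg.sub hf) hp).1 hp

end Besov

/-! ### The trace inequality and existence of traces -/

section Trace

variable {d : ℕ} {ρ : Euc d → ℝ} {p : ℝ≥0∞} {f g : Euc d → ℂ} {μ : Measure (Euc d)} [SFinite μ]

/-- `μ` behaves like a measure of codimension `m`, with constant `M`, at all scales finer than
`2 ^ (-J)`. -/
def HasCodimension (m : ℕ) (M : ℝ≥0∞) (J : ℤ) (μ : Measure (Euc d)) : Prop :=
  ∀ j : ℤ, J ≤ j → ∀ y : Euc d, ∫⁻ x, ENNReal.ofReal (decayWeight j (y - x)) ∂μ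
    ≤ M * ENNReal.ofReal (((2 : ℝ) ^ j) ^ m)

/-- The constant in the trace inequality for measures of codimension `m`. -/
noncomputable def traceConst (hρ : IsDyadicPartition ρ) (m : ℕ) (p M : ℝ≥0∞) : ℝ≥0∞ :=
  ENNReal.ofReal (decayConst hρ) * weightMass d ^ (1 - 1 / p.toReal) *
    (M * ENNReal.ofReal (2 ^ m)) ^ (1 / p.toReal)

theorem traceConst_ne_top (hρ : IsDyadicPartition ρ) (m : ℕ) {M : ℝ≥0∞} (hM : M ≠ ⊤)
    (hp : 1 ≤ p) : traceConst hρ m p M ≠ ⊤ := by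
  have hq := one_div_toReal_le_one hp
  refine ENNReal.mul_ne_top (ENNReal.mul_ne_top ENNReal.ofReal_ne_top ?_) ?_
  · exact ENNReal.rpow_ne_top_of_nonneg (by linarith) weightMass_ne_top
  · exact ENNReal.rpow_ne_top_of_nonneg (by positivity)
      (ENNReal.mul_ne_top hM ENNReal.ofReal_ne_top)

theorem ofReal_two_zpow_pow_rpow (j : ℤ) (m : ℕ) (q : ℝ) (hq : 0 ≤ q) :
    ENNReal.ofReal (((2 : ℝ) ^ j) ^ m) ^ (1 / q)
      = ENNReal.ofReal ((2 : ℝ) ^ ((j : ℝ) * (m / q))) := by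
  rw [ENNReal.ofReal_rpow_of_nonneg (by positivity) (by positivity), ← Real.rpow_natCast,
    ← Real.rpow_intCast, ← Real.rpow_mul two_pos.le, ← Real.rpow_mul two_pos.le]
  congr 2
  ring

/-- Schur's test with row mass `weightMass d` and column mass of order `2^(jm)`. The exponent is
written with `j - 1`, the spare `2^m` sitting in `traceConst`, to match the use of the filter `j +
1` on block `j`. -/
theorem eLpNorm_lowPass_le_of_hasCodimension (hρ : IsDyadicPartition ρ) {m : ℕ} {M : ℝ≥0∞}
    {J : ℤ} (hμ : HasCodimension m M J μ) {j : ℤ} (hj : J ≤ j)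
    (hf : AEStronglyMeasurable f volume) (hp : 1 ≤ p) : eLpNorm (lowPass hρ j f) p μ
      ≤ traceConst hρ m p M * ENNReal.ofReal ((2 : ℝ) ^ (((j - 1 : ℤ) : ℝ) * (m / p.toReal))) *
        eLpNorm f p volume := by
  refine (eLpNorm_lowPass_le hρ j f p).trans ?_
  calc _ ≤ ENNReal.ofReal (decayConst hρ) * (weightMass d ^ (1 - 1 / p.toReal) *
        (M * ENNReal.ofReal (((2 : ℝ) ^ j) ^ m)) ^ (1 / p.toReal) * eLpNorm f p volume) := by
        gcongr
        exact eLpNorm_weightedAverage_le hf (hμ j hj) hp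
    _ = _ := by
        have h2 : ((2 : ℝ) ^ j) ^ m = 2 ^ m * ((2 : ℝ) ^ (j - 1)) ^ m := by
          rw [← mul_pow, ← zpow_one_add₀ two_ne_zero]
          congr 2
          ring
        rw [h2, ENNReal.ofReal_mul (by positivity), ← mul_assoc M,
          ENNReal.mul_rpow_of_nonneg _ _ (by positivity),
          ofReal_two_zpow_pow_rpow _ _ _ ENNReal.toReal_nonneg, traceConst]
        ring

theorem eLpNorm_dyadicBlock_le_of_hasCodimension (hρ : IsDyadicPartition ρ) {m : ℕ} {M : ℝ≥0∞}
    {J : ℤ} (hμ : HasCodimension m M J μ) {j : ℤ} (hj : J ≤ j)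
    (hf : MemLp f p volume) (hp : 1 ≤ p) : eLpNorm (dyadicBlock ρ j f) p μ
      ≤ traceConst hρ m p M * besovTerm ρ (m / p.toReal) p f j := by
  have h := eLpNorm_lowPass_le_of_hasCodimension hρ hμ (j := j + 1) (by omega)
    (memLp_dyadicBlock hρ j hf hp).1 hp
  rwa [lowPass_dyadicBlock hρ j hf hp, add_sub_cancel_right, mul_assoc] at h

theorem tsum_eLpNorm_dyadicBlock_le (hρ : IsDyadicPartition ρ) {m : ℕ} {M : ℝ≥0∞}
    {J : ℤ} (hμ : HasCodimension m M J μ) (hf : MemLp f p volume) (hp : 1 ≤ p) :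
    ∑' k : ℕ, eLpNorm (dyadicBlock ρ (J + k + 1) f) p μ
      ≤ traceConst hρ m p M * besovSeminorm ρ (m / p.toReal) p f := by
  refine le_trans ?_ (mul_le_mul_right (tsum_besovTerm_add_le (J + 1)) _)
  rw [← ENNReal.tsum_mul_left]
  refine ENNReal.tsum_le_tsum fun k => ?_
  rw [add_right_comm]
  exact eLpNorm_dyadicBlock_le_of_hasCodimension hρ hμ (by omega) hf hp

theorem eLpNorm_sub_lowPass_le_of_continuous (hρ : IsDyadicPartition ρ) {m : ℕ} {M : ℝ≥0∞}
    {J : ℤ} (hμ : HasCodimension m M J μ) (hf : MemLp f p volume) (hc : Continuous f)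
    (hp : 1 ≤ p) : eLpNorm (f - lowPass hρ J f) p μ
      ≤ traceConst hρ m p M * besovSeminorm ρ (m / p.toReal) p f :=
  (eLpNorm_sub_lowPass_le_tsum hρ J hf hp (Eventually.of_forall fun x =>
    tendsto_lowPass_of_continuous hρ hf hp hc x)).trans (tsum_eLpNorm_dyadicBlock_le hρ hμ hf hp)

theorem IsBesovTrace.eLpNorm_sub_lowPass_le (hρ : IsDyadicPartition ρ) {m : ℕ} {M : ℝ≥0∞}
    {J : ℤ} (hμ : HasCodimension m M J μ) (hM : M ≠ ⊤) (hf : MemLp f p volume) (hp : 1 ≤ p)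
    (hg : IsBesovTrace ρ (m / p.toReal) p μ f g) : eLpNorm (g - lowPass hρ J f) p μ
      ≤ traceConst hρ m p M * besovSeminorm ρ (m / p.toReal) p f := by
  obtain ⟨hgm, u, hu, hub, hug⟩ := hg
  set s : ℝ := m / p.toReal
  set T := traceConst hρ m p M
  have hT : T ≠ ⊤ := traceConst_ne_top hρ m hM hp
  set D : ℝ≥0∞ := ENNReal.ofReal ((2 : ℝ) ^ (((J - 1 : ℤ) : ℝ) * s))
  have hu1 : Tendsto (fun n => eLpNorm (u n - f) p volume) atTop (𝓝 0) :=
    tendsto_of_tendsto_of_tendsto_of_le_of_le tendsto_const_nhds hub (fun _ => zero_le)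
      fun n => le_self_add
  have hu2 : Tendsto (fun n => besovSeminorm ρ s p (u n - f)) atTop (𝓝 0) :=
    tendsto_of_tendsto_of_tendsto_of_le_of_le tendsto_const_nhds hub (fun _ => zero_le)
      fun n => le_add_self
  have hlim : Tendsto (fun n => eLpNorm (u n - g) p μ +
      T * (besovSeminorm ρ s p f + besovSeminorm ρ s p (u n - f)) +
      T * D * eLpNorm (u n - f) p volume) atTop (𝓝 (T * besovSeminorm ρ s p f)) := by
    have h1 := ENNReal.Tendsto.const_mul (a := T) (hu2.const_add (besovSeminorm ρ s p f))
      (Or.inr hT)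
    have h2 := ENNReal.Tendsto.const_mul (a := T * D) hu1
      (Or.inr (ENNReal.mul_ne_top hT ENNReal.ofReal_ne_top))
    simpa using (hug.add h1).add h2
  refine ge_of_tendsto' hlim fun n => ?_
  have hun : MemLp (u n) p volume := (hu n).2.1
  have hcf := continuous_lowPass hρ J hf hp
  have hcu := continuous_lowPass hρ J hun hp
  -- The outer terms vanish in the limit and the middle one obeys the inequality for continuous
  -- functions; hence the bound holds for every trace, with no uniqueness argument.
  have he : g - lowPass hρ J f
      = (g - u n) + (u n - lowPass hρ J (u n)) + lowPass hρ J (u n - f) := by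
    rw [lowPass_sub hρ J hun hf hp]
    abel
  have hm1 : AEStronglyMeasurable (g - u n) μ := hgm.sub (hu n).1.aestronglyMeasurable
  have hm2 : AEStronglyMeasurable (u n - lowPass hρ J (u n)) μ :=
    ((hu n).1.sub hcu).aestronglyMeasurable
  have hm3 : AEStronglyMeasurable (lowPass hρ J (u n - f)) μ :=
    (continuous_lowPass hρ J (hun.sub hf) hp).aestronglyMeasurable
  rw [he]
  refine (eLpNorm_add_le (hm1.add hm2) hm3 hp).trans ?_
  gcongr ?_ + ?_
  · refine (eLpNorm_add_le hm1 hm2 hp).trans ?_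
    rw [eLpNorm_sub_comm]
    gcongr
    refine (eLpNorm_sub_lowPass_le_of_continuous hρ hμ hun (hu n).1 hp).trans ?_
    gcongr
    exact besovSeminorm_le_add hρ hf hun hp
  · exact eLpNorm_lowPass_le_of_hasCodimension hρ hμ le_rfl (hun.sub hf).1 hp

theorem exists_isBesovTrace (hρ : IsDyadicPartition ρ) {m : ℕ} {M : ℝ≥0∞}
    {J : ℤ} (hμ : HasCodimension m M J μ) (hM : M ≠ ⊤) (hp : 1 ≤ p)
    (hf : MemBesov ρ (m / p.toReal) p f) : ∃ g, IsBesovTrace ρ (m / p.toReal) p μ f g := by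
  set s : ℝ := m / p.toReal with hs_def
  have hs : 0 ≤ s := by positivity
  have hT : traceConst hρ m p M ≠ ⊤ := traceConst_ne_top hρ m hM hp
  have hA : ENNReal.ofReal (decayConst hρ) * weightMass d ≠ ⊤ :=
    ENNReal.mul_ne_top ENNReal.ofReal_ne_top weightMass_ne_top
  -- The approximants are the filtered functions. Consecutive ones differ by one block, and the
  -- blocks are summable in `L^p(μ)`.
  set u : ℕ → Euc d → ℂ := fun k => lowPass hρ (J + k) f with hu_def
  have hc : ∀ k, Continuous (u k) := fun k => continuous_lowPass hρ _ hf.1 hp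
  have hmem : ∀ k, MemLp (u k) p μ := fun k =>
    ⟨(hc k).aestronglyMeasurable, (eLpNorm_lowPass_le_of_hasCodimension hρ hμ (by omega)
      hf.1.1 hp).trans_lt (ENNReal.mul_lt_top (ENNReal.mul_lt_top hT.lt_top
        ENNReal.ofReal_lt_top) hf.1.2)⟩
  have : Fact (1 ≤ p) := ⟨hp⟩
  have hcau : CauchySeq fun k => (hmem k).toLp (u k) := by
    refine cauchySeq_of_edist_le_of_tsum_ne_top
      (fun k : ℕ => eLpNorm (dyadicBlock ρ (J + k + 1) f) p μ) (fun k => ?_) ?_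
    · rw [edist_comm, Lp.edist_toLp_toLp, dyadicBlock_eq hρ _ hf.1 hp, add_sub_cancel_right]
      simp only [hu_def, Nat.succ_eq_add_one, Nat.cast_add, Nat.cast_one, add_assoc, le_refl]
    · exact ((tsum_eLpNorm_dyadicBlock_le hρ hμ hf.1 hp).trans_lt
        (ENNReal.mul_lt_top hT.lt_top hf.2)).ne
  obtain ⟨g, hg⟩ := cauchySeq_tendsto_of_complete hcau
  refine ⟨g, Lp.aestronglyMeasurable g, u, fun k => ⟨hc k, memLp_lowPass hρ _ hf.1 hp,
    (besovSeminorm_lowPass_le hρ _ hf.1 hp).trans_lt (ENNReal.mul_lt_top hA.lt_top hf.2)⟩, ?_, ?_⟩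
  · have ht := tendsto_tsum_besovTerm J hf.2
    have h2 := ENNReal.Tendsto.const_mul
      (a := ENNReal.ofReal ((2 : ℝ) ^ (-(J : ℝ) * s)) +
        (ENNReal.ofReal (decayConst hρ) * weightMass d + 1)) ht
      (Or.inr (ENNReal.add_ne_top.2 ⟨ENNReal.ofReal_ne_top,
        ENNReal.add_ne_top.2 ⟨hA, ENNReal.one_ne_top⟩⟩))
    rw [mul_zero] at h2
    refine tendsto_of_tendsto_of_tendsto_of_le_of_le tendsto_const_nhds h2 (fun _ => zero_le)
      fun k => ?_
    simp only
    rw [add_mul]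
    gcongr ?_ + ?_
    · rw [eLpNorm_sub_comm]
      refine (eLpNorm_sub_lowPass_volume_le hρ (J + k) hf.1 hp hs).trans ?_
      gcongr
      · exact one_le_two
      · linarith [(Nat.cast_nonneg k : (0 : ℝ) ≤ k)]
    · exact besovSeminorm_lowPass_sub_le hρ (J + k) hf.1 hp
  · have h3 := (tendsto_iff_edist_tendsto_0.1 hg)
    refine h3.congr fun k => ?_
    rw [Lp.edist_def]
    exact eLpNorm_congr_ae ((hmem k).coeFn_toLp.sub (ae_eq_refl _))

end Trace

/-! ### Geometry of sampling sets and comparison of norms -/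

section Sampling

variable {d m : ℕ} {b C₀ : ℝ} {G : Set (Euc d)} {H : Euc d → Set (Euc d)}
  {ν : Euc d → Measure (Euc d)}

/-- The surface measure on `G`. -/
noncomputable abbrev samplingMeasure (m : ℕ) (G : Set (Euc d)) : Measure (Euc d) :=
  (μH[((d - m : ℕ) : ℝ)] : Measure (Euc d)).restrict G

theorem IsSamplingSet.measure_ball_le (hS : IsSamplingSet m b C₀ G H ν) (x : Euc d) {R : ℝ}
    (hR : 0 < R) : samplingMeasure m G (Metric.ball x R)
      ≤ ENNReal.ofReal (C₀ * R ^ (d - m) * max 1 (R * b⁻¹) ^ m) := by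
  rw [samplingMeasure, Measure.restrict_apply measurableSet_ball, inter_comm]
  exact hS.density_bound x R hR

theorem IsSamplingSet.sigmaFinite (hS : IsSamplingSet m b C₀ G H ν) :
    SigmaFinite (samplingMeasure m G) := by
  have : IsLocallyFiniteMeasure (samplingMeasure m G) :=
    ⟨fun x => ⟨Metric.ball x 1, Metric.ball_mem_nhds x one_pos,
      (hS.measure_ball_le x one_pos).trans_lt ENNReal.ofReal_lt_top⟩⟩
  infer_instance

/-- At scales at most `Q b` the maximum in the density bound is at most `(k+1) Q` on the ball of
radius `(k+1) 2^(-j)`. The powers `d - m` and `m` of `k + 1` then combine to `(k+1)^d`. -/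
theorem IsSamplingSet.hasCodimension (hS : IsSamplingSet m b C₀ G H ν) (hmd : m ≤ d)
    (hC₀ : 0 < C₀) (hb : 0 < b) {Q : ℝ} (hQ : 1 ≤ Q) {J : ℤ} (hJ : (2 : ℝ) ^ (-J) ≤ Q * b) :
    HasCodimension m (ENNReal.ofReal (C₀ * Q ^ m) * inverseSquareSum) J
      (samplingMeasure m G) := by
  intro j hj y
  have hj' : (2 : ℝ) ^ (-j) ≤ Q * b :=
    (zpow_le_zpow_right₀ one_le_two (by omega)).trans hJ
  refine (lintegral_decayWeight_le
    (M := ENNReal.ofReal (C₀ * ((2 : ℝ) ^ (-j)) ^ (d - m) * Q ^ m)) fun k => ?_).trans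
    (le_of_eq ?_)
  · refine (hS.measure_ball_le y (by positivity)).trans ?_
    rw [← ENNReal.ofReal_mul (by positivity)]
    apply ENNReal.ofReal_le_ofReal
    have hmax : max 1 (((k : ℝ) + 1) * 2 ^ (-j) * b⁻¹) ≤ ((k : ℝ) + 1) * Q := by
      refine max_le ?_ ?_
      · nlinarith [(Nat.cast_nonneg k : (0 : ℝ) ≤ k)]
      · rw [mul_assoc]
        gcongr
        rwa [← div_eq_mul_inv, div_le_iff₀ hb]
    calc C₀ * (((k : ℝ) + 1) * 2 ^ (-j)) ^ (d - m) *
          max 1 (((k : ℝ) + 1) * 2 ^ (-j) * b⁻¹) ^ m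
        ≤ C₀ * (((k : ℝ) + 1) * 2 ^ (-j)) ^ (d - m) * (((k : ℝ) + 1) * Q) ^ m := by gcongr
      _ = C₀ * ((2 : ℝ) ^ (-j)) ^ (d - m) * Q ^ m *
          (((k : ℝ) + 1) ^ (d - m) * ((k : ℝ) + 1) ^ m) := by
        rw [mul_pow, mul_pow]
        ring
      _ = _ := by rw [← pow_add, Nat.sub_add_cancel hmd]
  · have h2 : ((2 : ℝ) ^ j) ^ d = ((2 : ℝ) ^ j) ^ (d - m) * ((2 : ℝ) ^ j) ^ m := by
      rw [← pow_add, Nat.sub_add_cancel hmd]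
    have h3 : ((2 : ℝ) ^ j) ^ (d - m) * ((2 : ℝ) ^ (-j)) ^ (d - m) = 1 := by
      rw [← mul_pow, ← zpow_add₀ two_ne_zero]
      simp
    rw [← ENNReal.ofReal_mul (by positivity), mul_right_comm _ inverseSquareSum,
      ← ENNReal.ofReal_mul (by positivity)]
    congr 2
    rw [h2]
    linear_combination (C₀ * Q ^ m * ((2 : ℝ) ^ j) ^ m) * h3

/-- The Fubini condition passes from sets to functions by linearity and monotone convergence. -/
theorem IsSamplingSet.lintegral_fubini (hS : IsSamplingSet m b C₀ G H ν) {F : Euc d → ℝ≥0∞}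
    (hF : Measurable F) :
    AEMeasurable (fun a => ∫⁻ x in H a, F x ∂ν a) (samplingMeasure m G) ∧
    ENNReal.ofReal C₀⁻¹ * ∫⁻ x, F x ≤ ∫⁻ a, ∫⁻ x in H a, F x ∂ν a ∂samplingMeasure m G ∧
    ∫⁻ a, ∫⁻ x in H a, F x ∂ν a ∂samplingMeasure m G ≤ ENNReal.ofReal C₀ * ∫⁻ x, F x := by
  refine Measurable.ennreal_induction (motive := fun F =>
    AEMeasurable (fun a => ∫⁻ x in H a, F x ∂ν a) (samplingMeasure m G) ∧
    ENNReal.ofReal C₀⁻¹ * ∫⁻ x, F x ≤ ∫⁻ a, ∫⁻ x in H a, F x ∂ν a ∂samplingMeasure m G ∧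
    ∫⁻ a, ∫⁻ x in H a, F x ∂ν a ∂samplingMeasure m G ≤ ENNReal.ofReal C₀ * ∫⁻ x, F x)
    (fun c s hs => ?_) (fun f g _ hf hg ihf ihg => ?_) (fun f hf hmono ih => ?_) hF
  · have he : ∀ a, ∫⁻ x in H a, s.indicator (fun _ => c) x ∂ν a = c * ν a (s ∩ H a) := by
      intro a
      rw [lintegral_indicator_const hs, Measure.restrict_apply hs]
    simp_rw [he]
    have hm := hS.aemeasurable_fubini s hs
    rw [lintegral_const_mul'' _ hm, lintegral_indicator_const hs, mul_left_comm, mul_left_comm _ c]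
    refine ⟨hm.const_mul c, ?_, ?_⟩
    · gcongr
      exact (hS.fubini s hs).1
    · gcongr
      exact (hS.fubini s hs).2
  · simp only [Pi.add_apply]
    simp_rw [lintegral_add_left hf]
    rw [lintegral_add_left' ihf.1, mul_add, mul_add]
    exact ⟨ihf.1.add ihg.1, add_le_add ihf.2.1 ihg.2.1, add_le_add ihf.2.2 ihg.2.2⟩
  · simp_rw [lintegral_iSup hf hmono]
    rw [lintegral_iSup' (fun n => (ih n).1) (Eventually.of_forall fun a i j hij =>
      lintegral_mono fun x => hmono hij x), ENNReal.mul_iSup, ENNReal.mul_iSup]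
    exact ⟨AEMeasurable.iSup fun n => (ih n).1, iSup_mono fun n => (ih n).2.1,
      iSup_mono fun n => (ih n).2.2⟩

theorem IsSamplingSet.norm_sub_le (hS : IsSamplingSet m b C₀ G H ν) (hb : 0 < b) {a x : Euc d}
    (ha : a ∈ G) (hx : x ∈ H a) : ‖x - a‖ ≤ b := by
  have hd := hS.diam_piece a ha
  -- `Metric.diam` of an unbounded set is 0, which the lower bound `b / 2` excludes.
  have hbd : Bornology.IsBounded (H a) := by
    by_contra h
    have := Metric.diam_eq_zero_of_unbounded h
    linarith
  rw [← dist_eq_norm]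
  exact (Metric.dist_le_diam_of_mem hbd hx (hS.mem_piece a ha)).trans hd.2

theorem IsSamplingSet.measure_piece_le (hS : IsSamplingSet m b C₀ G H ν) (hb : 0 < b) {a : Euc d}
    (ha : a ∈ G) : ν a (H a) ≤ ENNReal.ofReal (C₀ * b ^ m) := by
  have h := hS.piece_upper a ha a (2 * b) (by positivity)
  rw [min_eq_right (by linarith)] at h
  have hsub : H a ⊆ Metric.ball a (2 * b) ∩ H a := by
    refine fun x hx => ⟨?_, hx⟩
    rw [Metric.mem_ball, dist_eq_norm]
    linarith [hS.norm_sub_le hb ha hx]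
  exact (measure_mono hsub).trans h

/-- The constant in the comparison of `L^p` norms on the whole space and on a sampling set. -/
noncomputable def samplingConst (C₀ : ℝ) (p : ℝ≥0∞) : ℝ≥0∞ :=
  (ENNReal.ofReal C₀ * 2 ^ (p.toReal - 1) * ENNReal.ofReal C₀) ^ (1 / p.toReal)

theorem two_rpow_ne_top (r : ℝ) : (2 : ℝ≥0∞) ^ r ≠ ⊤ := by
  simp [ENNReal.rpow_eq_top_iff]

theorem samplingConst_ne_top (C₀ : ℝ) (p : ℝ≥0∞) : samplingConst C₀ p ≠ ⊤ := by
  refine ENNReal.rpow_ne_top_of_nonneg (by positivity) (ENNReal.mul_ne_top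
    (ENNReal.mul_ne_top ENNReal.ofReal_ne_top ?_) ENNReal.ofReal_ne_top)
  exact two_rpow_ne_top _

/-- The pointwise comparison is raised to the power `p`, integrated over each piece and then over
`G`. The mass `C₀ b^m` of a piece produces the factor `b^(m/p)`. -/
theorem IsSamplingSet.eLpNorm_le (hS : IsSamplingSet m b C₀ G H ν) (hC₀ : 0 < C₀) (hb : 0 < b)
    {p : ℝ≥0∞} (hp : 1 ≤ p) {h : Euc d → ℂ} (hh : Measurable h) {T : Euc d → ℝ≥0∞}
    (hT : Measurable T) (hle : ∀ a ∈ G, ∀ x ∈ H a, ‖h x‖ₑ ≤ ‖h a‖ₑ + T x) :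
    eLpNorm h p volume ≤ samplingConst C₀ p *
      (ENNReal.ofReal (b ^ ((m : ℝ) / p.toReal)) * eLpNorm h p (samplingMeasure m G) +
        eLpNorm T p volume) := by
  have hG : ∀ᵐ a ∂samplingMeasure m G, a ∈ G := ae_restrict_mem hS.measurableSet
  have hc : ENNReal.ofReal C₀ * ENNReal.ofReal C₀⁻¹ = 1 := by
    rw [← ENNReal.ofReal_mul hC₀.le, mul_inv_cancel₀ hC₀.ne', ENNReal.ofReal_one]
  rcases eq_or_ne p ∞ with rfl | hpt
  · simp only [samplingConst, ENNReal.toReal_top, div_zero, ENNReal.rpow_zero, Real.rpow_zero,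
      ENNReal.ofReal_one, one_mul, eLpNorm_exponent_top]
    set M := eLpNormEssSup h (samplingMeasure m G)
    -- For `p = ∞`: almost every piece misses this exceptional set, so the lower Fubini bound makes
    -- it Lebesgue-null.
    set E := {x | M + T x < ‖h x‖ₑ}
    have hE : MeasurableSet E := measurableSet_lt (measurable_const.add hT) hh.enorm
    have h0 : ∫⁻ a in G, ν a (E ∩ H a) ∂(μH[((d - m : ℕ) : ℝ)] : Measure (Euc d)) = 0 := by
      rw [lintegral_eq_zero_iff' (hS.aemeasurable_fubini E hE)]
      filter_upwards [hG, enorm_ae_le_eLpNormEssSup h (samplingMeasure m G)] with a ha hM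
      have : E ∩ H a = ∅ := by
        ext x
        simp only [mem_inter_iff, mem_empty_iff_false, iff_false, not_and]
        intro hx hxa
        exact absurd ((hle a ha x hxa).trans (add_le_add_left hM _)) (not_le.2 hx)
      simp [this]
    have hv : volume E = 0 := by
      have h1 := (hS.fubini E hE).1
      rw [h0, nonpos_iff_eq_zero, mul_eq_zero] at h1
      refine h1.resolve_left fun h2 => ?_
      rw [h2, mul_zero] at hc
      exact zero_ne_one hc
    have hv' : ∀ᵐ x, x ∉ E := measure_eq_zero_iff_ae_notMem.1 hv
    refine eLpNormEssSup_le_of_ae_enorm_bound ?_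
    filter_upwards [hv', enorm_ae_le_eLpNormEssSup T volume] with x hx hTx
    refine (not_lt.1 hx).trans ?_
    gcongr
    simpa using hTx
  have hp0 : p ≠ 0 := (zero_lt_one.trans_le hp).ne'
  have hq : 1 ≤ p.toReal := by
    rw [← ENNReal.toReal_one]
    exact ENNReal.toReal_mono hpt hp
  rw [eLpNorm_eq_lintegral_rpow_enorm_toReal hp0 hpt, eLpNorm_eq_lintegral_rpow_enorm_toReal hp0 hpt,
    eLpNorm_eq_lintegral_rpow_enorm_toReal hp0 hpt, samplingConst]
  simp only [enorm_eq_self]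
  set q := p.toReal
  have hq0 : 0 < q := by linarith
  have hq1 : 1 / q ≤ 1 := by rw [div_le_one hq0]; exact hq
  have hfT := hS.lintegral_fubini (hT.pow_const q)
  have hfh := hS.lintegral_fubini (hh.enorm.pow_const q)
  have hpiece : ∀ᵐ a ∂samplingMeasure m G, ∫⁻ x in H a, ‖h x‖ₑ ^ q ∂ν a
      ≤ 2 ^ (q - 1) * (ENNReal.ofReal (C₀ * b ^ m) * ‖h a‖ₑ ^ q + ∫⁻ x in H a, T x ^ q ∂ν a) := by
    filter_upwards [hG] with a ha
    calc ∫⁻ x in H a, ‖h x‖ₑ ^ q ∂ν a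
        ≤ ∫⁻ x in H a, 2 ^ (q - 1) * (‖h a‖ₑ ^ q + T x ^ q) ∂ν a := by
          refine setLIntegral_mono' (hS.piece_measurableSet a ha) fun x hx => ?_
          exact (ENNReal.rpow_le_rpow (hle a ha x hx) hq0.le).trans
            (ENNReal.rpow_add_le_mul_rpow_add_rpow _ _ hq)
      _ = 2 ^ (q - 1) * (‖h a‖ₑ ^ q * ν a (H a) + ∫⁻ x in H a, T x ^ q ∂ν a) := by
          rw [lintegral_const_mul' _ _ (two_rpow_ne_top _),
            lintegral_add_left measurable_const, setLIntegral_const]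
      _ ≤ _ := by
          rw [mul_comm (‖h a‖ₑ ^ q)]
          gcongr
          exact hS.measure_piece_le hb ha
  have hmain : ∫⁻ x, ‖h x‖ₑ ^ q ≤ (ENNReal.ofReal C₀ * 2 ^ (q - 1) * ENNReal.ofReal C₀) *
      (ENNReal.ofReal (b ^ m) * ∫⁻ a, ‖h a‖ₑ ^ q ∂samplingMeasure m G + ∫⁻ x, T x ^ q) := by
    calc ∫⁻ x, ‖h x‖ₑ ^ q = ENNReal.ofReal C₀ * (ENNReal.ofReal C₀⁻¹ * ∫⁻ x, ‖h x‖ₑ ^ q) := by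
          rw [← mul_assoc, hc, one_mul]
      _ ≤ ENNReal.ofReal C₀ * ∫⁻ a, 2 ^ (q - 1) * (ENNReal.ofReal (C₀ * b ^ m) * ‖h a‖ₑ ^ q +
            ∫⁻ x in H a, T x ^ q ∂ν a) ∂samplingMeasure m G := by
          gcongr
          exact hfh.2.1.trans (lintegral_mono_ae hpiece)
      _ = ENNReal.ofReal C₀ * (2 ^ (q - 1) * (ENNReal.ofReal (C₀ * b ^ m) *
            ∫⁻ a, ‖h a‖ₑ ^ q ∂samplingMeasure m G +
            ∫⁻ a, ∫⁻ x in H a, T x ^ q ∂ν a ∂samplingMeasure m G)) := by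
          rw [lintegral_const_mul' _ _ (two_rpow_ne_top _),
            lintegral_add_left ((hh.enorm.pow_const q).const_mul _),
            lintegral_const_mul _ (hh.enorm.pow_const q)]
      _ ≤ ENNReal.ofReal C₀ * (2 ^ (q - 1) * (ENNReal.ofReal (C₀ * b ^ m) *
            ∫⁻ a, ‖h a‖ₑ ^ q ∂samplingMeasure m G + ENNReal.ofReal C₀ * ∫⁻ x, T x ^ q)) := by
          gcongr
          exact hfT.2.2
      _ = _ := by
          rw [ENNReal.ofReal_mul hC₀.le]
          ring
  refine (ENNReal.rpow_le_rpow hmain (by positivity : 0 ≤ 1 / q)).trans ?_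
  rw [ENNReal.mul_rpow_of_nonneg _ _ (by positivity : 0 ≤ 1 / q)]
  gcongr
  refine (ENNReal.rpow_add_le_add_rpow _ _ (by positivity) hq1).trans ?_
  rw [ENNReal.mul_rpow_of_nonneg _ _ (by positivity : 0 ≤ 1 / q),
    ENNReal.ofReal_rpow_of_nonneg (by positivity) (by positivity), ← Real.rpow_natCast,
    ← Real.rpow_mul hb.le, mul_one_div]

theorem measurable_weightedAverage (n : ℤ) {f : Euc d → ℂ} (hf : AEStronglyMeasurable f volume) :
    Measurable (weightedAverage n f) := by
  have he : weightedAverage n f = fun x =>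
      ∫⁻ y, ENNReal.ofReal (decayWeight n (x - y)) * ‖hf.mk f y‖ₑ := by
    ext x
    refine lintegral_congr_ae ?_
    filter_upwards [hf.ae_eq_mk] with y hy
    rw [hy]
  rw [he]
  exact Measurable.lintegral_prod_right' (f := fun z : Euc d × Euc d =>
    ENNReal.ofReal (decayWeight n (z.1 - z.2)) * ‖hf.mk f z.2‖ₑ)
    ((measurable_decayWeight_sub n).mul
      (hf.stronglyMeasurable_mk.measurable.comp measurable_snd).enorm)

theorem IsSamplingSet.eLpNorm_lowPass_le (hS : IsSamplingSet m b C₀ G H ν) (hC₀ : 0 < C₀)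
    (hb : 0 < b) {ρ : Euc d → ℝ} (hρ : IsDyadicPartition ρ) {p : ℝ≥0∞} (hp : 1 ≤ p)
    {f : Euc d → ℂ} (hf : MemLp f p volume) {J : ℤ} {t : ℝ} (hJ : 2 ^ J * b ≤ t) (ht : t ≤ 1) :
    eLpNorm (lowPass hρ J f) p volume ≤ samplingConst C₀ p *
      (ENNReal.ofReal (b ^ ((m : ℝ) / p.toReal)) *
          eLpNorm (lowPass hρ J f) p (samplingMeasure m G) +
        ENNReal.ofReal (decayConst hρ * t) * weightMass d * eLpNorm f p volume) := by
  have hm := measurable_weightedAverage J hf.1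
  refine (hS.eLpNorm_le hC₀ hb hp (continuous_lowPass hρ J hf hp).measurable
    (T := fun x => ENNReal.ofReal (decayConst hρ * t) * weightedAverage J f x)
    (hm.const_mul _) fun a ha x hx => ?_).trans ?_
  · have h := enorm_lowPass_sub_le hρ J hf hp x a (t := t)
      (le_trans (by gcongr; exact hS.norm_sub_le hb ha hx) hJ) ht
    calc ‖lowPass hρ J f x‖ₑ
        = ‖lowPass hρ J f a + (lowPass hρ J f x - lowPass hρ J f a)‖ₑ := by
          rw [add_sub_cancel]
      _ ≤ _ := (enorm_add_le _ _).trans (by gcongr)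
  · gcongr
    rw [mul_assoc]
    refine (eLpNorm_le_nnreal_smul_eLpNorm_of_ae_le_mul' (g := weightedAverage J f)
      (c := (decayConst hρ * t).toNNReal) (Eventually.of_forall fun x => le_rfl) p).trans ?_
    change ENNReal.ofReal (decayConst hρ * t) * _ ≤ _
    gcongr
    exact eLpNorm_weightedAverage_volume_le hf.1 hp

end Sampling

/-! ### Choice of constants and the main theorem -/

theorem exists_pos_mul_ofReal_le_quarter {A : ℝ≥0∞} (hA : A ≠ ⊤) :
    ∃ t : ℝ, 0 < t ∧ t ≤ 1 ∧ A * ENNReal.ofReal t ≤ 1 / 4 := by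
  have h0 : 0 ≤ A.toReal := ENNReal.toReal_nonneg
  refine ⟨1 / (4 * (A.toReal + 1)), by positivity, ?_, ?_⟩
  · rw [div_le_one (by positivity)]
    linarith
  · rw [← ENNReal.ofReal_toReal hA, ← ENNReal.ofReal_mul h0,
      show (1 / 4 : ℝ≥0∞) = ENNReal.ofReal (1 / 4) by
        rw [ENNReal.ofReal_div_of_pos (by norm_num)]; norm_num]
    apply ENNReal.ofReal_le_ofReal
    rw [ENNReal.toReal_ofReal h0, mul_one_div, div_le_div_iff₀ (by positivity) (by norm_num)]
    linarith

theorem ENNReal.le_two_mul_of_le_half_add {x y : ℝ≥0∞} (hx : x ≠ ⊤) (h : x ≤ x / 2 + y) :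
    x ≤ 2 * y := by
  rw [← ENNReal.add_halves x] at h
  nth_rw 2 [ENNReal.add_halves] at h
  have h2 := (ENNReal.add_le_add_iff_left (ENNReal.div_ne_top hx two_ne_zero)).1 h
  rw [mul_comm]
  exact (ENNReal.div_le_iff two_ne_zero ENNReal.ofNat_ne_top).1 h2

section Main

variable {d m : ℕ} {b C₀ : ℝ} {G : Set (Euc d)} {H : Euc d → Set (Euc d)}
  {ν : Euc d → Measure (Euc d)} {ρ : Euc d → ℝ} {p : ℝ≥0∞}

/-- The constant of codimension of a sampling set at scales finer than `2 * b / t`. -/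
noncomputable def codimensionConst (m : ℕ) (C₀ t : ℝ) : ℝ≥0∞ :=
  ENNReal.ofReal (C₀ * (2 / t) ^ m) * inverseSquareSum

theorem codimensionConst_ne_top (m : ℕ) (C₀ t : ℝ) : codimensionConst m C₀ t ≠ ⊤ :=
  ENNReal.mul_ne_top ENNReal.ofReal_ne_top inverseSquareSum_ne_top

/-- A dyadic frequency comparable to `t / b`. -/
theorem exists_two_zpow_mul_le {b t : ℝ} (hb : 0 < b) (ht : 0 < t) :
    ∃ J : ℤ, 2 ^ J * b ≤ t ∧ (2 : ℝ) ^ (-J) ≤ 2 / t * b := by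
  obtain ⟨J, h1, h2⟩ := exists_mem_Ico_zpow (div_pos ht hb) (one_lt_two (α := ℝ))
  refine ⟨J, (le_div_iff₀ hb).1 h1, ?_⟩
  rw [zpow_add_one₀ two_ne_zero, div_lt_iff₀ hb] at h2
  rw [zpow_neg, inv_le_iff_one_le_mul₀ (by positivity), div_mul_eq_mul_div, div_mul_eq_mul_div,
    le_div_iff₀ ht]
  linarith

/-- Schur's test costs at most `2^(Js)` up to a constant, and `2^J b ≤ 1` cancels this against
`b^s`. -/
theorem IsSamplingSet.mul_eLpNorm_lowPass_le (hS : IsSamplingSet m b C₀ G H ν)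
    (hρ : IsDyadicPartition ρ) (hp : 1 ≤ p) (hb : 0 < b) {M : ℝ≥0∞} {J : ℤ}
    (hμ : HasCodimension m M J (samplingMeasure m G)) (hJ : 2 ^ J * b ≤ 1)
    {f : Euc d → ℂ} (hf : MemLp f p volume) :
    ENNReal.ofReal (b ^ ((m : ℝ) / p.toReal)) * eLpNorm (lowPass hρ J f) p (samplingMeasure m G)
      ≤ traceConst hρ m p M * eLpNorm f p volume := by
  have := hS.sigmaFinite
  set s := (m : ℝ) / p.toReal
  have hs : 0 ≤ s := by positivity
  calc _ ≤ ENNReal.ofReal (b ^ s) * (traceConst hρ m p M *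
        ENNReal.ofReal ((2 : ℝ) ^ (((J - 1 : ℤ) : ℝ) * s)) * eLpNorm f p volume) := by
        gcongr
        exact eLpNorm_lowPass_le_of_hasCodimension hρ hμ le_rfl hf.1 hp
    _ = ENNReal.ofReal (b ^ s * (2 : ℝ) ^ (((J - 1 : ℤ) : ℝ) * s)) *
        (traceConst hρ m p M * eLpNorm f p volume) := by
        rw [ENNReal.ofReal_mul (by positivity)]
        ring
    _ ≤ 1 * (traceConst hρ m p M * eLpNorm f p volume) := by
        gcongr
        rw [ENNReal.ofReal_le_one, Real.rpow_mul two_pos.le, ← Real.mul_rpow hb.le (by positivity),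
          Real.rpow_intCast]
        refine Real.rpow_le_one (by positivity) ?_ hs
        have : (2 : ℝ) ^ (J - 1) ≤ 2 ^ J := zpow_le_zpow_right₀ one_le_two (by omega)
        nlinarith
    _ = _ := one_mul _

theorem eLpNorm_sub_lowPass_le_mul_besovSeminorm (hρ : IsDyadicPartition ρ) (hp : 1 ≤ p)
    (hb : 0 < b) {Q : ℝ} (hQ : 0 < Q) {J : ℤ} (hJ : (2 : ℝ) ^ (-J) ≤ Q * b) {s : ℝ} (hs : 0 ≤ s)
    {f : Euc d → ℂ} (hf : MemLp f p volume) : eLpNorm (f - lowPass hρ J f) p volume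
      ≤ ENNReal.ofReal (Q ^ s) * (ENNReal.ofReal (b ^ s) * besovSeminorm ρ s p f) := by
  refine (eLpNorm_sub_lowPass_volume_le hρ J hf hp hs).trans ?_
  rw [← mul_assoc, ← ENNReal.ofReal_mul (by positivity), ← Real.mul_rpow hQ.le hb.le,
    Real.rpow_mul two_pos.le]
  gcongr
  · rwa [← Int.cast_neg, Real.rpow_intCast]
  · exact tsum_besovTerm_add_le J

end Main

theorem mainTheorem2 (d m : ℕ) (hm : 1 ≤ m) (hmd : m ≤ d) (p : ℝ≥0∞) (hp : 1 ≤ p)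
    (C₀ : ℝ) (hC₀ : 0 < C₀) (ρ : Euc d → ℝ) (hρ : IsDyadicPartition ρ) :
    ∃ δ C₁ C₂ : ℝ, 0 < δ ∧ 0 < C₁ ∧ 0 < C₂ ∧
      ∀ (b : ℝ), 0 < b →
      ∀ (G : Set (Euc d)) (H : Euc d → Set (Euc d)) (ν : Euc d → Measure (Euc d)),
        IsSamplingSet m b C₀ G H ν →
      ∀ (f : Euc d → ℂ), MemBesov ρ ((m : ℝ) / p.toReal) p f →
      ∀ (N : ℝ), 0 < N →
        besovSeminorm ρ ((m : ℝ) / p.toReal) p f ≤ ENNReal.ofReal N * eLpNorm f p volume →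
        b ^ ((m : ℝ) / p.toReal) < δ * N⁻¹ →
        (∃ g : Euc d → ℂ, IsBesovTrace ρ ((m : ℝ) / p.toReal) p
          ((μH[((d - m : ℕ) : ℝ)] : Measure (Euc d)).restrict G) f g) ∧
        ∀ g : Euc d → ℂ, IsBesovTrace ρ ((m : ℝ) / p.toReal) p
            ((μH[((d - m : ℕ) : ℝ)] : Measure (Euc d)).restrict G) f g →
          ENNReal.ofReal C₁ * eLpNorm f p volume
              ≤ ENNReal.ofReal (b ^ ((m : ℝ) / p.toReal)) *
                  eLpNorm g p ((μH[((d - m : ℕ) : ℝ)] : Measure (Euc d)).restrict G) ∧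
            ENNReal.ofReal (b ^ ((m : ℝ) / p.toReal)) *
                  eLpNorm g p ((μH[((d - m : ℕ) : ℝ)] : Measure (Euc d)).restrict G)
              ≤ ENNReal.ofReal C₂ * eLpNorm f p volume := by
  set s : ℝ := (m : ℝ) / p.toReal
  have hs : 0 ≤ s := by positivity
  set A := samplingConst C₀ p
  have hA : A ≠ ⊤ := samplingConst_ne_top C₀ p
  -- `t` is fixed before `δ`: it makes the oscillation error at most `‖f‖_p / 4`, while the trace
  -- constant `T` and the factor `Q` depend on `t`.
  obtain ⟨t, ht0, ht1, ht⟩ := exists_pos_mul_ofReal_le_quarter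
    (ENNReal.mul_ne_top hA (ENNReal.mul_ne_top (ENNReal.ofReal_ne_top (r := decayConst hρ))
      (weightMass_ne_top (d := d))))
  set M := codimensionConst m C₀ t
  have hM : M ≠ ⊤ := codimensionConst_ne_top m C₀ t
  set T := traceConst hρ m p M
  have hT : T ≠ ⊤ := traceConst_ne_top hρ m hM hp
  set Q := ENNReal.ofReal ((2 / t) ^ s)
  have hQ1 : 1 ≤ 2 / t := by
    rw [le_div_iff₀ ht0]
    linarith
  -- `δ` makes the two high-frequency errors, in `L^p` (factor `Q`) and on `G` (factor `A T`),
  -- together at most `‖f‖_p / 4`.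
  obtain ⟨δ, hδ0, hδ1, hδ⟩ := exists_pos_mul_ofReal_le_quarter
    (ENNReal.add_ne_top.2 ⟨ENNReal.ofReal_ne_top (r := (2 / t) ^ s), ENNReal.mul_ne_top hA hT⟩)
  have hA0 : 0 ≤ A.toReal := ENNReal.toReal_nonneg
  have hT0 : 0 ≤ T.toReal := ENNReal.toReal_nonneg
  -- The added 1 keeps the constants well defined and positive even if `A` or `T` is 0.
  refine ⟨δ, 1 / (2 * (A.toReal + 1)), T.toReal + T.toReal + 1, hδ0, by positivity, by positivity,
    fun b hb G H ν hS f hf N hN hfN hbN => ?_⟩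
  have hσ := hS.sigmaFinite
  obtain ⟨J, hJ1, hJ2⟩ := exists_two_zpow_mul_le hb ht0
  have hμ : HasCodimension m M J (samplingMeasure m G) :=
    hS.hasCodimension hmd hC₀ hb hQ1 hJ2
  refine ⟨exists_isBesovTrace hρ hμ hM hp hf, fun g hg => ?_⟩
  set Φ := eLpNorm f p volume
  have hΦ : Φ ≠ ⊤ := hf.1.2.ne
  set β := ENNReal.ofReal (b ^ s)
  set h := lowPass hρ J f
  set X := β * eLpNorm g p (samplingMeasure m G)
  have hB : β * besovSeminorm ρ s p f ≤ ENNReal.ofReal δ * Φ := by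
    calc β * besovSeminorm ρ s p f ≤ β * (ENNReal.ofReal N * Φ) := by gcongr
      _ = ENNReal.ofReal (b ^ s * N) * Φ := by
        rw [ENNReal.ofReal_mul (by positivity), mul_assoc]
      _ ≤ _ := by
        gcongr
        rw [← div_eq_mul_inv, lt_div_iff₀ hN] at hbN
        exact hbN.le
  have hg1 : β * eLpNorm (g - h) p (samplingMeasure m G) ≤ T * (ENNReal.ofReal δ * Φ) := by
    calc _ ≤ β * (T * besovSeminorm ρ s p f) := by
          gcongr
          exact hg.eLpNorm_sub_lowPass_le hρ hμ hM hf.1 hp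
      _ = T * (β * besovSeminorm ρ s p f) := by ring
      _ ≤ _ := by gcongr
  have hhc : Continuous h := continuous_lowPass hρ J hf.1 hp
  have hh : β * eLpNorm h p (samplingMeasure m G) ≤ T * Φ :=
    hS.mul_eLpNorm_lowPass_le hρ hp hb hμ (hJ1.trans ht1) hf.1
  have hgm : AEStronglyMeasurable (g - h) (samplingMeasure m G) :=
    hg.1.sub hhc.aestronglyMeasurable
  have hX : X ≤ T * (ENNReal.ofReal δ * Φ) + T * Φ := by
    have he : g = (g - h) + h := (sub_add_cancel g h).symm
    calc X ≤ β * (eLpNorm (g - h) p (samplingMeasure m G) +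
          eLpNorm h p (samplingMeasure m G)) := by
          refine mul_le_mul_right ?_ β
          nth_rw 1 [he]
          exact eLpNorm_add_le hgm hhc.aestronglyMeasurable hp
      _ ≤ _ := by
          rw [mul_add]
          gcongr
  have hhX : β * eLpNorm h p (samplingMeasure m G) ≤ X + T * (ENNReal.ofReal δ * Φ) := by
    have he : h = g - (g - h) := (sub_sub_cancel g h).symm
    calc _ ≤ β * (eLpNorm g p (samplingMeasure m G) +
          eLpNorm (g - h) p (samplingMeasure m G)) := by
          gcongr
          nth_rw 1 [he]
          exact eLpNorm_sub_le hg.1 hgm hp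
      _ ≤ _ := by
          rw [mul_add]
          gcongr
  constructor
  -- The two quarters form the half to be absorbed, which is legitimate because `Φ` is finite.
  · have hlow : Φ ≤ Φ / 2 + A * X := by
      have hf1 : Φ ≤ eLpNorm (f - h) p volume + eLpNorm h p volume := by
        have he : f = (f - h) + h := (sub_add_cancel f h).symm
        calc Φ = eLpNorm ((f - h) + h) p volume := by rw [← he]
          _ ≤ _ := eLpNorm_add_le (hf.1.1.sub hhc.aestronglyMeasurable)
            hhc.aestronglyMeasurable hp
      have hf2 : eLpNorm (f - h) p volume ≤ Q * (ENNReal.ofReal δ * Φ) :=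
        (eLpNorm_sub_lowPass_le_mul_besovSeminorm hρ hp hb (by positivity) hJ2 hs hf.1).trans
          (by gcongr)
      have hf3 := hS.eLpNorm_lowPass_le hC₀ hb hρ hp hf.1 hJ1 ht1
      have h4 : (1 / 4 + 1 / 4 : ℝ≥0∞) = 2⁻¹ := by
        rw [← ENNReal.toReal_eq_toReal_iff' (by simp) (by simp),
          ENNReal.toReal_add (by simp) (by simp)]
        norm_num
      calc Φ ≤ Q * (ENNReal.ofReal δ * Φ) + A * ((X + T * (ENNReal.ofReal δ * Φ)) +
            ENNReal.ofReal (decayConst hρ * t) * weightMass d * Φ) := by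
            refine hf1.trans (add_le_add hf2 (hf3.trans ?_))
            gcongr
        _ = (Q + A * T) * ENNReal.ofReal δ * Φ +
            A * (ENNReal.ofReal (decayConst hρ) * weightMass d) * ENNReal.ofReal t * Φ +
            A * X := by
            rw [ENNReal.ofReal_mul (decayConst_pos hρ).le]
            ring
        _ ≤ 1 / 4 * Φ + 1 / 4 * Φ + A * X := by gcongr
        _ = Φ / 2 + A * X := by
            rw [← add_mul, h4, div_eq_mul_inv, mul_comm]
    have h2 : Φ ≤ ENNReal.ofReal (2 * (A.toReal + 1)) * X := by
      refine (ENNReal.le_two_mul_of_le_half_add hΦ hlow).trans ?_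
      rw [← mul_assoc, ENNReal.ofReal_mul two_pos.le, ENNReal.ofReal_ofNat]
      gcongr
      rw [ENNReal.ofReal_add hA0 one_pos.le, ENNReal.ofReal_toReal hA]
      exact le_self_add
    calc _ ≤ ENNReal.ofReal (1 / (2 * (A.toReal + 1))) *
          (ENNReal.ofReal (2 * (A.toReal + 1)) * X) := by gcongr
      _ = X := by
        rw [← mul_assoc, ← ENNReal.ofReal_mul (by positivity), one_div_mul_cancel (by positivity),
          ENNReal.ofReal_one, one_mul]
  · calc X ≤ T * (ENNReal.ofReal δ * Φ) + T * Φ := hX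
      _ ≤ T * (1 * Φ) + T * Φ := by
        gcongr
        exact ENNReal.ofReal_le_one.2 hδ1
      _ = (T + T) * Φ := by ring
      _ ≤ _ := by
        gcongr
        rw [ENNReal.ofReal_add (by positivity) one_pos.le, ENNReal.ofReal_add hT0 hT0,
          ENNReal.ofReal_toReal hT]
        exact le_self_add
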